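/- Let $k$ be an algebraically closed field of characteristic zero. Let $Q_A$ and $Q_B$ be finite quivers with the same vertex set $\{1,\dots,n\}$ such that every arrow $i\to j$ of $Q_A$ or of $Q_B$ satisfies $i<j$, and let $A=kQ_A/I_A$ and $B=kQ_B/I_B$, where $I_A$ and $I_B$ are generated by sets $Z_A$ and $Z_B$ of paths of length at least two (that is, $A$ and $B$ are directed monomial algebras with the same ordering of the vertices). Paths are composed from right to left. Let $\Lambda=\Lambda(B,A^{\mathrm{op}})=kQ/I$ be the dual extension algebra: $Q$ has vertices $1,\dots,n$, and its arrows are the arrows of $Q_B$ together with an arrow $\beta'\colon j\to i$ for each arrow $\beta\colon i\to j$ of $Q_A$; the ideal $I$ is generated by $Z_B$, by the reversed paths of $Z_A$, and by all paths $\alpha\beta'$ (first $\beta'$, then $\alpha$) with $\alpha$ an arrow of $Q_B$ and $\beta$ an arrow of $Q_A$. Regard $B$ as a subalgebra of $\Lambda$. For a $k$-algebra $R$ and a subalgebra $S\subseteq R$ let $\mathrm{HH}^1(R)=\mathrm{Der}_k(R)/\mathrm{Inn}_k(R)$ and let $\mathrm{HH}^1(R|S)=\mathrm{Der}_{S^e}(R)/\mathrm{Inn}_{S^e}(R)$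 be the quotient of the derivations that are $S$-bimodule maps by the inner derivations that are $S$-bimodule maps; both are Lie algebras under the commutator bracket. If $R=\Lambda$ or $R=B$, graded by path length, let $\mathrm{HH}^1(R)_{|_1}$ and $\mathrm{HH}^1(R|S)_{|_1}$ be the Lie subalgebras of the classes represented by derivations (in the second case, derivations that are $S$-bimodule maps) that preserve the path length grading, i.e. that send each arrow to a linear combination of parallel arrows. Then there is an isomorphism of Lie algebras \[ \mathrm{HH}^1(\Lambda)_{|_1}\;\cong\;\mathrm{HH}^1(B)_{|_1}\oplus \mathrm{HH}^1(\Lambda|B)_{|_1}. \] -/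

import Mathlib

universe u v w

noncomputable section

namespace DualExt

/-! ### Paths and path algebras

Quivers are Mathlib's `Quiver`, handled as explicit terms because several quivers on the same
vertex set occur at once. -/

/-- A path in the quiver `Q`, together with its source and its target. -/
structure QPath {V : Type w} (Q : Quiver.{v} V) where
  src : V
  tgt : V
  path : @Quiver.Path V Q src tgt

namespace QPath

variable {V : Type w} {Q : Quiver.{v} V}

/-- The number of arrows in a path. -/
def length (p : QPath Q) : ℕ := @Quiver.Path.length V Q _ _ p.path

/-- The path of length zero at a vertex. -/
def idem (Q : Quiver.{v} V) (i : V) : QPath Q := ⟨i, i, @Quiver.Path.nil V Q i⟩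

/-- The path of length one given by an arrow. -/
def arrow {i j : V} (a : Q.Hom i j) : QPath Q := ⟨i, j, @Quiver.Hom.toPath V Q i j a⟩

/-- The concatenation `p q`, written from right to left: first `q`, then `p`. -/
def comp (p q : QPath Q) (h : q.tgt = p.src) : QPath Q :=
  ⟨q.src, p.tgt, @Quiver.Path.comp V Q _ _ _ (@Quiver.Path.cast V Q _ _ _ _ rfl h q.path) p.path⟩

/-- The image of a path under a map of quivers which is the identity on vertices. -/
def map {Q' : Quiver.{v} V} (φ : ∀ i j, Q.Hom i j → Q'.Hom i j) (p : QPath Q) : QPath Q' :=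
  ⟨p.src, p.tgt, @Prefunctor.mapPath V Q V Q' (@Prefunctor.mk V Q V Q' id (fun {i j} a => φ i j a))
    _ _ p.path⟩

theorem comp_assoc (p q r : QPath Q) (h : q.tgt = p.src) (h' : r.tgt = q.src) :
    comp (comp p q h) r h' = comp p (comp q r h') h := by
  obtain ⟨a, b, p⟩ := p
  obtain ⟨c, d, q⟩ := q
  obtain ⟨e, f, r⟩ := r
  dsimp at h h'
  subst h h'
  simp [comp]

theorem comp_idem (p : QPath Q) (i : V) (h : i = p.src) : comp p (idem Q i) h = p := by
  obtain ⟨a, b, p⟩ := p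
  dsimp at h
  subst h
  simp [comp, idem]

theorem idem_comp (p : QPath Q) (i : V) (h : p.tgt = i) : comp (idem Q i) p h = p := by
  obtain ⟨a, b, p⟩ := p
  dsimp at h
  subst h
  simp [comp, idem]

theorem map_comp {Q' : Quiver.{v} V} (φ : ∀ i j, Q.Hom i j → Q'.Hom i j) (p q : QPath Q)
    (h : q.tgt = p.src) : map φ (comp p q h) = comp (map φ p) (map φ q) h := by
  obtain ⟨a, b, p⟩ := p
  obtain ⟨c, d, q⟩ := q
  dsimp at h
  subst h
  simp [comp, map]

end QPath

/-- The path algebra `kQ`: the vector space with basis the paths of `Q`. -/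
def PathAlgebra (k : Type u) [Field k] {V : Type w} (Q : Quiver.{v} V) :
    Type (max u v w) :=
  QPath Q →₀ k

namespace PathAlgebra

variable (k : Type u) [Field k] {V : Type w}

instance (Q : Quiver.{v} V) : AddCommGroup (PathAlgebra k Q) :=
  inferInstanceAs (AddCommGroup (QPath Q →₀ k))

instance (Q : Quiver.{v} V) : Module k (PathAlgebra k Q) :=
  inferInstanceAs (Module k (QPath Q →₀ k))

/-- The basis element of the path algebra given by a path. -/
def of {Q : Quiver.{v} V} (p : QPath Q) : PathAlgebra k Q :=
  (Finsupp.single p 1 : QPath Q →₀ k)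

/-- The linear map on the path algebra with prescribed values on the paths. -/
def extend {Q : Quiver.{v} V} {M : Type*} [AddCommGroup M] [Module k M] (f : QPath Q → M) :
    PathAlgebra k Q →ₗ[k] M :=
  Finsupp.linearCombination k f

variable {k}

@[simp]
theorem extend_of {Q : Quiver.{v} V} {M : Type*} [AddCommGroup M] [Module k M]
    (f : QPath Q → M) (p : QPath Q) : extend k f (of k p) = f p := by
  exact (Finsupp.linearCombination_single k 1 p).trans (one_smul k (f p))

theorem hom_ext {Q : Quiver.{v} V} {M : Type*} [AddCommGroup M] [Module k M]
    {f g : PathAlgebra k Q →ₗ[k] M} (h : ∀ p, f (of k p) = g (of k p)) : f = g :=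
  Finsupp.lhom_ext' fun p => LinearMap.ext_ring (h p)

variable (k) [DecidableEq V]

/-- The product of two paths: their concatenation if they can be composed, and zero otherwise. -/
def mulPath {Q : Quiver.{v} V} (p q : QPath Q) : PathAlgebra k Q :=
  if h : q.tgt = p.src then of k (p.comp q h) else 0

/-- The multiplication of the path algebra. -/
def mulHom (Q : Quiver.{v} V) :
    PathAlgebra k Q →ₗ[k] PathAlgebra k Q →ₗ[k] PathAlgebra k Q :=
  extend k fun p => extend k fun q => mulPath k p q

variable {k}

@[simp]
theorem mulHom_of {Q : Quiver.{v} V} (p q : QPath Q) :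
    mulHom k Q (of k p) (of k q) = mulPath k p q := by
  simp [mulHom]

theorem mulHom_assoc {Q : Quiver.{v} V} (x y z : PathAlgebra k Q) :
    mulHom k Q (mulHom k Q x y) z = mulHom k Q x (mulHom k Q y z) := by
  have key : ∀ p q r : QPath Q, mulHom k Q (mulHom k Q (of k p) (of k q)) (of k r) =
      mulHom k Q (of k p) (mulHom k Q (of k q) (of k r)) := by
    intro p q r
    by_cases h : q.tgt = p.src
    · by_cases h' : r.tgt = q.src
      · have h1 : (q.comp r h').tgt = p.src := h
        have h2 : r.tgt = (p.comp q h).src := h'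
        simp only [mulHom_of, mulPath, dif_pos h, dif_pos h', dif_pos h1, dif_pos h2]
        exact congrArg (of k) (QPath.comp_assoc p q r h h')
      · have h2 : ¬ r.tgt = (p.comp q h).src := h'
        simp [mulPath, h, h', h2]
    · by_cases h' : r.tgt = q.src
      · have h1 : ¬ (q.comp r h').tgt = p.src := h
        simp [mulPath, h, h', h1]
      · simp [mulPath, h, h']
  have key₁ : ∀ (p q : QPath Q) (z : PathAlgebra k Q),
      mulHom k Q (mulHom k Q (of k p) (of k q)) z =
        mulHom k Q (of k p) (mulHom k Q (of k q) z) := fun p q z =>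
    LinearMap.congr_fun (f := mulHom k Q (mulHom k Q (of k p) (of k q)))
      (g := (mulHom k Q (of k p)).comp (mulHom k Q (of k q))) (hom_ext (key p q)) z
  have key₂ : ∀ (p : QPath Q) (y z : PathAlgebra k Q),
      mulHom k Q (mulHom k Q (of k p) y) z =
        mulHom k Q (of k p) (mulHom k Q y z) := fun p y z =>
    LinearMap.congr_fun (f := ((mulHom k Q).flip z).comp (mulHom k Q (of k p)))
      (g := (mulHom k Q (of k p)).comp ((mulHom k Q).flip z))
      (hom_ext fun q => key₁ p q z) y
  exact LinearMap.congr_fun (f := ((mulHom k Q).flip z).comp ((mulHom k Q).flip y))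
    (g := (mulHom k Q).flip (mulHom k Q y z)) (hom_ext fun p => key₂ p y z) x

variable [Fintype V]

/-- The unit of the path algebra: the sum of the paths of length zero. -/
def one (k : Type u) [Field k] (Q : Quiver.{v} V) : PathAlgebra k Q :=
  ∑ i : V, of k (QPath.idem Q i)

theorem one_mulHom {Q : Quiver.{v} V} (x : PathAlgebra k Q) :
    mulHom k Q (one k Q) x = x := by
  have : mulHom k Q (one k Q) = LinearMap.id := by
    refine hom_ext fun p => ?_
    simp only [one, map_sum, LinearMap.sum_apply, mulHom_of, LinearMap.id_apply]
    rw [Finset.sum_eq_single p.tgt]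
    · exact (dif_pos rfl).trans (congrArg (of k) (QPath.idem_comp p _ rfl))
    · intro i _ hi
      exact dif_neg (fun h => hi h.symm)
    · simp
  rw [this, LinearMap.id_apply]

theorem mulHom_one {Q : Quiver.{v} V} (x : PathAlgebra k Q) :
    mulHom k Q x (one k Q) = x := by
  have : (mulHom k Q).flip (one k Q) = LinearMap.id := by
    refine hom_ext fun p => ?_
    simp only [one, map_sum, LinearMap.sum_apply, LinearMap.flip_apply, mulHom_of,
      LinearMap.id_apply]
    rw [Finset.sum_eq_single p.src]
    · exact (dif_pos rfl).trans (congrArg (of k) (QPath.comp_idem p _ rfl))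
    · intro i _ hi
      exact dif_neg (fun h => hi h)
    · simp
  exact congr($this x)

instance (Q : Quiver.{v} V) : Ring (PathAlgebra k Q) :=
  { (inferInstance : AddCommGroup (PathAlgebra k Q)) with
    mul := fun x y => mulHom k Q x y
    one := one k Q
    left_distrib := fun x y z => map_add (mulHom k Q x) y z
    right_distrib := fun x y z => LinearMap.map_add₂ (mulHom k Q) x y z
    zero_mul := fun x => LinearMap.map_zero₂ (mulHom k Q) x
    mul_zero := fun x => map_zero (mulHom k Q x)
    mul_assoc := mulHom_assoc
    one_mul := one_mulHom
    mul_one := mulHom_one }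

theorem mul_def {Q : Quiver.{v} V} (x y : PathAlgebra k Q) : x * y = mulHom k Q x y := rfl

theorem one_def (Q : Quiver.{v} V) :
    (1 : PathAlgebra k Q) = ∑ i : V, of k (QPath.idem Q i) := rfl

instance (Q : Quiver.{v} V) : Algebra k (PathAlgebra k Q) :=
  Algebra.ofModule
    (fun r x y => LinearMap.map_smul₂ (mulHom k Q) r x y)
    (fun r x y => map_smul (mulHom k Q x) r y)

/-- The homomorphism of path algebras induced by a map of quivers which is the identity on
vertices. -/
def map {Q Q' : Quiver.{v} V} (φ : ∀ i j, Q.Hom i j → Q'.Hom i j) :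
    PathAlgebra k Q →ₐ[k] PathAlgebra k Q' :=
  AlgHom.ofLinearMap (extend k fun p => of k (p.map φ))
    (by simp only [one_def, map_sum, extend_of]; rfl)
    (by
      intro x y
      have : (mulHom k Q).compr₂ (extend k fun p => of k (p.map φ)) =
          (mulHom k Q').compl₁₂ (extend k fun p => of k (p.map φ))
            (extend k fun p => of k (p.map φ)) := by
        refine hom_ext fun p => hom_ext fun q => ?_
        simp only [LinearMap.compr₂_apply, LinearMap.compl₁₂_apply, mulHom_of, extend_of]
        by_cases h : q.tgt = p.src
        · have h' : (q.map φ).tgt = (p.map φ).src := h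
          simp only [mulPath, dif_pos h, dif_pos h', extend_of, QPath.map_comp]
        · have h' : ¬ (q.map φ).tgt = (p.map φ).src := h
          simp only [mulPath, dif_neg h, dif_neg h', map_zero]
      exact congr($this x y))

@[simp]
theorem map_of {Q Q' : Quiver.{v} V} (φ : ∀ i j, Q.Hom i j → Q'.Hom i j) (p : QPath Q) :
    map φ (of k p) = of k (p.map φ) :=
  extend_of _ p

end PathAlgebra

/-! ### Monomial algebras and dual extensions -/

section Monomial

variable (k : Type u) [Field k] {V : Type w} [DecidableEq V] [Fintype V]

/-- The two-sided ideal of `kQ` generated by a set `Z` of paths. -/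
def relIdeal {Q : Quiver.{v} V} (Z : Set (QPath Q)) : Ideal (PathAlgebra k Q) :=
  (TwoSidedIdeal.span (PathAlgebra.of k '' Z)).asIdeal

instance {Q : Quiver.{v} V} (Z : Set (QPath Q)) : (relIdeal k Z).IsTwoSided :=
  inferInstanceAs (TwoSidedIdeal.span (PathAlgebra.of k '' Z)).asIdeal.IsTwoSided

/-- The monomial algebra `kQ / (Z)`. -/
abbrev MonomialAlgebra {Q : Quiver.{v} V} (Z : Set (QPath Q)) : Type (max u v w) :=
  PathAlgebra k Q ⧸ relIdeal k Z

/-- The grading of `kQ / (Z)` by path length: the component of degree `n` is spanned by the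
residue classes of the paths of length `n`. -/
def lengthGrading {Q : Quiver.{v} V} (Z : Set (QPath Q)) (n : ℕ) :
    Submodule k (MonomialAlgebra k Z) :=
  Submodule.span k
    ((fun p : QPath Q => Ideal.Quotient.mk (relIdeal k Z) (PathAlgebra.of k p)) ''
      {p | p.length = n})

end Monomial

section DualExtension

variable {V : Type w}

/-- The quiver of the dual extension of `B` and `A`: it has the given vertices, the arrows of
`Q_B`, and an arrow from `i` to `j` for every arrow of `Q_A` from `j` to `i`. -/
@[reducible]
def dualQuiver (QB QA : Quiver.{v} V) : Quiver.{v} V :=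
  ⟨fun i j => QB.Hom i j ⊕ QA.Hom j i⟩

/-- The arrow of the dual extension given by an arrow of `Q_B`. -/
def inclArrow (QB QA : Quiver.{v} V) (i j : V) (b : QB.Hom i j) : (dualQuiver QB QA).Hom i j :=
  Sum.inl b

/-- The arrow of the dual extension given by (the opposite of) an arrow of `Q_A`. -/
def opArrow (QB QA : Quiver.{v} V) (i j : V) (a : QA.Hom i j) : (dualQuiver QB QA).Hom j i :=
  Sum.inr a

/-- The path in the dual extension obtained from a path of `Q_A` by reversing it. -/
def opPathAux (QB QA : Quiver.{v} V) {i : V} :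
    ∀ {j : V}, @Quiver.Path V QA i j → @Quiver.Path V (dualQuiver QB QA) j i
  | _, @Quiver.Path.nil _ _ _ => @Quiver.Path.nil V (dualQuiver QB QA) i
  | _, @Quiver.Path.cons _ _ _ _ _ p a =>
      @Quiver.Path.comp V (dualQuiver QB QA) _ _ _
        (@Quiver.Hom.toPath V (dualQuiver QB QA) _ _ (opArrow QB QA _ _ a)) (opPathAux QB QA p)

/-- The path in the dual extension obtained from a path of `Q_A` by reversing it. -/
def opPath (QB QA : Quiver.{v} V) (p : QPath QA) : QPath (dualQuiver QB QA) :=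
  ⟨p.tgt, p.src, opPathAux QB QA p.path⟩

/-- The relations of the dual extension `Λ(B, A^op)`: the relations of `B`, the reversed
relations of `A`, and all paths `α β'` of length two (first `β'`, then `α`) with `α` an arrow of
`Q_B` and `β'` the opposite of an arrow of `Q_A`. -/
def dualRelations {QB QA : Quiver.{v} V} (ZB : Set (QPath QB)) (ZA : Set (QPath QA)) :
    Set (QPath (dualQuiver QB QA)) :=
  QPath.map (inclArrow QB QA) '' ZB ∪ opPath QB QA '' ZA ∪
    {r | ∃ (i j l : V) (β : QA.Hom j i) (α : QB.Hom j l),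
      r = (QPath.arrow (inclArrow QB QA j l α)).comp (QPath.arrow (opArrow QB QA j i β)) rfl}

end DualExtension

section Borel

variable (k : Type u) [Field k] {V : Type w} [DecidableEq V] [Fintype V]

theorem relIdeal_le_comap {QB QA : Quiver.{v} V} (ZB : Set (QPath QB)) (ZA : Set (QPath QA))
    (x : PathAlgebra k QB) (hx : x ∈ relIdeal k ZB) :
    PathAlgebra.map (inclArrow QB QA) x ∈ relIdeal k (dualRelations ZB ZA) := by
  have h : TwoSidedIdeal.span (PathAlgebra.of k '' ZB) ≤
      (TwoSidedIdeal.span (PathAlgebra.of k '' dualRelations ZB ZA)).comap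
        (PathAlgebra.map (k := k) (inclArrow QB QA)) := by
    rw [TwoSidedIdeal.span_le]
    rintro _ ⟨p, hp, rfl⟩
    rw [SetLike.mem_coe, TwoSidedIdeal.mem_comap, PathAlgebra.map_of]
    exact TwoSidedIdeal.subset_span ⟨_, Or.inl (Or.inl ⟨p, hp, rfl⟩), rfl⟩
  exact TwoSidedIdeal.mem_asIdeal.2
    ((TwoSidedIdeal.mem_comap _).1 (h (TwoSidedIdeal.mem_asIdeal.1 hx)))

/-- The dual extension algebra `Λ(B, A^op)` of `B = kQ_B / (Z_B)` and `A = kQ_A / (Z_A)`. -/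
abbrev DualExtension {QB QA : Quiver.{v} V} (ZB : Set (QPath QB)) (ZA : Set (QPath QA)) :
    Type (max u v w) :=
  MonomialAlgebra k (dualRelations ZB ZA)

/-- The canonical homomorphism from `B` to `Λ(B, A^op)`, sending a path to the same path. -/
def borelHom {QB QA : Quiver.{v} V} (ZB : Set (QPath QB)) (ZA : Set (QPath QA)) :
    MonomialAlgebra k ZB →ₐ[k] DualExtension k ZB ZA :=
  Ideal.quotientMapₐ (relIdeal k (dualRelations ZB ZA)) (PathAlgebra.map (inclArrow QB QA))
    (fun x hx => relIdeal_le_comap k ZB ZA x hx)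

/-- `B` as a subalgebra of `Λ(B, A^op)`. -/
def borel {QB QA : Quiver.{v} V} (ZB : Set (QPath QB)) (ZA : Set (QPath QA)) :
    Subalgebra k (DualExtension k ZB ZA) :=
  (borelHom k ZB ZA).range

end Borel

/-! ### First (relative) Hochschild cohomology as a Lie algebra -/

section Hochschild

attribute [local instance 100] LieRing.ofAssociativeRing

variable (k : Type u) [Field k] (A : Type v) [Ring A] [Algebra k A]

/-- The Lie algebra `Der_k(A)`, with the commutator bracket `f ∘ g - g ∘ f`. -/
def derivations : LieSubalgebra k (Module.End k A) where
  carrier := {f | ∀ x y, f (x * y) = f x * y + x * f y}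
  add_mem' := by
    intro f g hf hg x y
    simp only [LinearMap.add_apply, hf x y, hg x y, add_mul, mul_add]
    abel
  zero_mem' := by
    intro x y
    simp
  smul_mem' := by
    intro c f hf x y
    simp [hf x y]
  lie_mem' := by
    intro f g hf hg x y
    have hf' : ∀ x y, f (x * y) = f x * y + x * f y := hf
    have hg' : ∀ x y, g (x * y) = g x * y + x * g y := hg
    simp only [LieRing.of_associative_ring_bracket, LinearMap.sub_apply, Module.End.mul_apply,
      hf', hg', map_add, sub_mul, mul_sub]
    abel

variable {A}

/-- The Lie algebra of the endomorphisms of `A` as a `B`-bimodule. -/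
def bimoduleEnd (B : Subalgebra k A) : LieSubalgebra k (Module.End k A) where
  carrier := {f | ∀ b ∈ B, ∀ b' ∈ B, ∀ x, f (b * x * b') = b * f x * b'}
  add_mem' := by
    intro f g hf hg b hb b' hb' x
    simp only [LinearMap.add_apply, hf b hb b' hb' x, hg b hb b' hb' x, add_mul, mul_add]
  zero_mem' := by
    intro b hb b' hb' x
    simp
  smul_mem' := by
    intro c f hf b hb b' hb' x
    simp [hf b hb b' hb' x]
  lie_mem' := by
    intro f g hf hg b hb b' hb' x
    simp only [LieRing.of_associative_ring_bracket, LinearMap.sub_apply, Module.End.mul_apply,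
      hf b hb b' hb' _, hg b hb b' hb' _, sub_mul, mul_sub]

/-- The Lie algebra `Der_{B^e}(A)` of derivations of `A` that are maps of `B`-bimodules. -/
def relDerivations (B : Subalgebra k A) : LieSubalgebra k (Module.End k A) :=
  derivations k A ⊓ bimoduleEnd k B

/-- The inner derivation `y ↦ x y - y x`. -/
def ad (x : A) : Module.End k A := LinearMap.mulLeft k x - LinearMap.mulRight k x

theorem lie_ad {f : Module.End k A} (hf : f ∈ derivations k A) (x : A) :
    ⁅f, ad k x⁆ = ad k (f x) := by
  have hf' : ∀ x y, f (x * y) = f x * y + x * f y := hf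
  ext y
  simp only [LieRing.of_associative_ring_bracket, LinearMap.sub_apply, Module.End.mul_apply, ad,
    LinearMap.mulLeft_apply, LinearMap.mulRight_apply, map_sub, hf']
  abel

theorem ad_add (x y : A) : ad k (x + y) = ad k x + ad k y := by
  ext z
  simp only [ad, LinearMap.sub_apply, LinearMap.mulLeft_apply, LinearMap.mulRight_apply,
    LinearMap.add_apply, add_mul, mul_add]
  abel

theorem ad_smul (c : k) (x : A) : ad k (c • x) = c • ad k x := by
  ext z
  simp [ad, smul_sub]

/-- The inner derivations that lie in a Lie algebra `D` of derivations, as an ideal of `D`. -/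
def innerIdeal (D : LieSubalgebra k (Module.End k A)) (hD : D ≤ derivations k A) :
    LieIdeal k D where
  carrier := {f | ∃ x : A, (f : Module.End k A) = ad k x}
  add_mem' := by
    rintro f g ⟨x, hx⟩ ⟨y, hy⟩
    exact ⟨x + y, by rw [ad_add, ← hx, ← hy]; rfl⟩
  zero_mem' := ⟨0, by ext; simp [ad]⟩
  smul_mem' := by
    rintro c f ⟨x, hx⟩
    exact ⟨c • x, by rw [ad_smul, ← hx]; rfl⟩
  lie_mem := by
    rintro f g ⟨x, hx⟩
    exact ⟨(f : Module.End k A) x, by rw [← lie_ad k (hD f.2), ← hx]; rfl⟩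

variable (A) in
/-- The first Hochschild cohomology `HH¹(A) = Der_k(A) / Inn_k(A)`. -/
abbrev HH1 : Type v := derivations k A ⧸ innerIdeal k (derivations k A) le_rfl

/-- The first relative Hochschild cohomology `HH¹(A|B) = Der_{B^e}(A) / Inn_{B^e}(A)`. -/
abbrev RelHH1 (B : Subalgebra k A) : Type v :=
  relDerivations k B ⧸ innerIdeal k (relDerivations k B) inf_le_left

/-- The endomorphisms of `A` that map every component of a grading to itself. -/
def degreePreserving (𝒜 : ℕ → Submodule k A) : LieSubalgebra k (Module.End k A) where
  carrier := {f | ∀ n, ∀ x ∈ 𝒜 n, f x ∈ 𝒜 n}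
  add_mem' := by
    intro f g hf hg n x hx
    exact add_mem (hf n x hx) (hg n x hx)
  zero_mem' := by
    intro n x _
    exact zero_mem _
  smul_mem' := by
    intro c f hf n x hx
    exact Submodule.smul_mem _ c (hf n x hx)
  lie_mem' := by
    intro f g hf hg n x hx
    exact sub_mem (hf n _ (hg n x hx)) (hg n _ (hf n x hx))

/-- The classes in `D / I` that are represented by elements of `D` lying in `P`. -/
def classesIn (D P : LieSubalgebra k (Module.End k A)) (I : LieIdeal k D) :
    LieSubalgebra k (D ⧸ I) where
  carrier := {c | ∃ f : D, (f : Module.End k A) ∈ P ∧ LieSubmodule.Quotient.mk f = c}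
  add_mem' := by
    rintro _ _ ⟨f, hf, rfl⟩ ⟨g, hg, rfl⟩
    exact ⟨f + g, add_mem hf hg, rfl⟩
  zero_mem' := ⟨0, zero_mem P, rfl⟩
  smul_mem' := by
    rintro c _ ⟨f, hf, rfl⟩
    exact ⟨c • f, P.smul_mem c hf, rfl⟩
  lie_mem' := by
    rintro _ _ ⟨f, hf, rfl⟩ ⟨g, hg, rfl⟩
    exact ⟨⁅f, g⁆, P.lie_mem hf hg, rfl⟩

/-- The component `HH¹(A)_{|1}` of degree one, for a graded algebra `A`. In the grading of `HH¹`
used here, the component of degree `i` consists of the classes of the derivations that map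
the component `n` of `A` to the component `n + i - 1`. So in degree one the derivations preserve
the grading of `A` (an arrow is sent to a combination of parallel arrows). -/
def HH1DegOne (𝒜 : ℕ → Submodule k A) : LieSubalgebra k (HH1 k A) :=
  classesIn k (derivations k A) (degreePreserving k 𝒜) _

/-- The component `HH¹(A|B)_{|1}` of degree one, with the same convention. -/
def RelHH1DegOne (𝒜 : ℕ → Submodule k A) (B : Subalgebra k A) : LieSubalgebra k (RelHH1 k B) :=
  classesIn k (relDerivations k B) (degreePreserving k 𝒜) _

end Hochschild

end DualExt

end

noncomputable section

namespace DualExt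

attribute [local instance 100] LieRing.ofAssociativeRing

/-! ### The universal property of path algebras and of monomial algebras -/

section Lift

variable {k : Type u} [Field k] {V : Type w} [Fintype V] {Q : Quiver.{v} V}
variable {R : Type*} [Ring R] [Algebra k R]

/-- The value of a path, given values of the vertices and of the arrows. -/
def evalPath (e : V → R) (x : ∀ i j, Q.Hom i j → R) {i : V} :
    ∀ {j : V}, @Quiver.Path V Q i j → R
  | _, @Quiver.Path.nil _ _ _ => e i
  | _, @Quiver.Path.cons _ _ _ _ _ p a => x _ _ a * evalPath e x p

/-- Values of the vertices and of the arrows of `Q` in a ring that define a homomorphism from the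
path algebra: the vertices go to a complete family of orthogonal idempotents, and the arrows
are compatible with them. -/
structure IsQuiverHom (e : V → R) (x : ∀ i j, Q.Hom i j → R) : Prop where
  idem : ∀ i, e i * e i = e i
  ortho : ∀ i j, i ≠ j → e i * e j = 0
  sum : ∑ i, e i = 1
  left : ∀ i j (a : Q.Hom i j), e j * x i j a = x i j a
  right : ∀ i j (a : Q.Hom i j), x i j a * e i = x i j a

namespace IsQuiverHom

variable {e : V → R} {x : ∀ i j, Q.Hom i j → R} (h : IsQuiverHom e x)
include h

theorem tgt_mul_evalPath {i j : V} (p : @Quiver.Path V Q i j) :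
    e j * evalPath e x p = evalPath e x p := by
  cases p with
  | nil => exact h.idem i
  | cons p a => simp only [evalPath, ← mul_assoc, h.left]

theorem evalPath_mul_src {i j : V} (p : @Quiver.Path V Q i j) :
    evalPath e x p * e i = evalPath e x p := by
  induction p with
  | nil => exact h.idem i
  | cons p a ih => simp only [evalPath, mul_assoc, ih]

theorem evalPath_comp {i j l : V} (p : @Quiver.Path V Q i j) (q : @Quiver.Path V Q j l) :
    evalPath e x (@Quiver.Path.comp V Q _ _ _ p q) = evalPath e x q * evalPath e x p := by
  induction q with
  | nil => exact (h.tgt_mul_evalPath p).symm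
  | cons q a ih => simp only [Quiver.Path.comp_cons, evalPath, mul_assoc, ih]

theorem evalPath_toPath {i j : V} (a : Q.Hom i j) :
    evalPath e x (@Quiver.Hom.toPath V Q i j a) = x i j a :=
  h.right i j a

end IsQuiverHom

variable [DecidableEq V]

/-- The homomorphism from the path algebra with given values of the vertices and arrows. -/
def PathAlgebra.lift {e : V → R} {x : ∀ i j, Q.Hom i j → R} (h : IsQuiverHom e x) :
    PathAlgebra k Q →ₐ[k] R :=
  AlgHom.ofLinearMap (extend k fun p => evalPath e x p.path)
    (by simp only [one_def, map_sum, extend_of]; exact h.sum)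
    (by
      intro y z
      have : (mulHom k Q).compr₂ (extend k fun p => evalPath e x p.path) =
          (LinearMap.mul k R).compl₁₂ (extend k fun p => evalPath e x p.path)
            (extend k fun p => evalPath e x p.path) := by
        refine hom_ext fun p => hom_ext fun q => ?_
        simp only [LinearMap.compr₂_apply, LinearMap.compl₁₂_apply, mulHom_of, extend_of,
          LinearMap.mul_apply']
        obtain ⟨a, b, p⟩ := p
        obtain ⟨c, d, q⟩ := q
        by_cases hc : d = a
        · subst hc
          simp only [mulPath, dif_pos, extend_of]
          exact h.evalPath_comp q p
        · simp only [mulPath, dif_neg hc, map_zero]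
          rw [← h.evalPath_mul_src p, ← h.tgt_mul_evalPath q, mul_assoc, ← mul_assoc (e a),
            h.ortho _ _ (Ne.symm hc), zero_mul, mul_zero]
      exact congr($this y z))

@[simp]
theorem PathAlgebra.lift_of {e : V → R} {x : ∀ i j, Q.Hom i j → R} (h : IsQuiverHom e x)
    (p : QPath Q) : lift h (of k p) = evalPath e x p.path :=
  extend_of _ p

theorem relIdeal_le_of_mem {Z : Set (QPath Q)} (J : TwoSidedIdeal (PathAlgebra k Q))
    (hJ : ∀ z ∈ Z, PathAlgebra.of k z ∈ J) {y : PathAlgebra k Q} (hy : y ∈ relIdeal k Z) :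
    y ∈ J := by
  have : TwoSidedIdeal.span (PathAlgebra.of k '' Z) ≤ J := by
    rw [TwoSidedIdeal.span_le]
    rintro _ ⟨z, hz, rfl⟩
    exact hJ z hz
  exact this (TwoSidedIdeal.mem_asIdeal.1 hy)

/-- The homomorphism from a monomial algebra with given values of the vertices and arrows. -/
def MonomialAlgebra.lift {Z : Set (QPath Q)} {e : V → R} {x : ∀ i j, Q.Hom i j → R}
    (h : IsQuiverHom e x) (hZ : ∀ z ∈ Z, evalPath e x z.path = 0) :
    MonomialAlgebra k Z →ₐ[k] R :=
  Ideal.Quotient.liftₐ (relIdeal k Z) (PathAlgebra.lift h) fun y hy => by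
    have := relIdeal_le_of_mem (TwoSidedIdeal.ker (PathAlgebra.lift (k := k) h))
      (fun z hz => by rw [TwoSidedIdeal.mem_ker, PathAlgebra.lift_of, hZ z hz]) hy
    rwa [TwoSidedIdeal.mem_ker] at this

end Lift

section Length

variable {V : Type w} {Q : Quiver.{v} V}

theorem QPath.length_comp (p q : QPath Q) (h : q.tgt = p.src) :
    (p.comp q h).length = p.length + q.length := by
  obtain ⟨a, b, p⟩ := p
  obtain ⟨c, d, q⟩ := q
  dsimp at h
  subst h
  exact (@Quiver.Path.length_comp V Q _ _ q _ p).trans (Nat.add_comm _ _)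

theorem QPath.eq_idem_of_length {p : QPath Q} (h : p.length = 0) : p = QPath.idem Q p.src := by
  obtain ⟨i, j, p⟩ := p
  cases p with
  | nil => rfl
  | cons p a => exact absurd h (Nat.succ_ne_zero _)

theorem QPath.eq_arrow_of_length {p : QPath Q} (h : p.length = 1) :
    ∃ a : Q.Hom p.src p.tgt, p = QPath.arrow a := by
  obtain ⟨i, j, p⟩ := p
  cases p with
  | nil => exact absurd h Nat.zero_ne_one
  | cons p a =>
    cases p with
    | nil => exact ⟨a, rfl⟩
    | cons p b => exact absurd (Nat.succ_injective h) (Nat.succ_ne_zero _)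

theorem QPath.arrow_injective {i j : V} :
    Function.Injective (QPath.arrow (Q := Q) (i := i) (j := j)) := by
  intro a b h
  simp only [QPath.arrow, QPath.mk.injEq, heq_eq_eq, true_and] at h
  exact eq_of_heq (@Quiver.Path.hom_heq_of_cons_eq_cons V Q _ _ _ _ _ _ _ _ h)

end Length

/-! ### Residue classes of paths -/

section Classes

variable (k : Type u) [Field k] {V : Type w} [DecidableEq V] [Fintype V] {Q : Quiver.{v} V}
  (Z : Set (QPath Q))

/-- The residue class of a path in a monomial algebra. -/
def pathClass (p : QPath Q) : MonomialAlgebra k Z :=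
  Ideal.Quotient.mk (relIdeal k Z) (PathAlgebra.of k p)

/-- The idempotent of a vertex in a monomial algebra. -/
def vertexClass (i : V) : MonomialAlgebra k Z := pathClass k Z (QPath.idem Q i)

/-- The residue class of an arrow in a monomial algebra. -/
def arrowClass {i j : V} (a : Q.Hom i j) : MonomialAlgebra k Z := pathClass k Z (QPath.arrow a)

variable {k Z}

theorem pathClass_eq_zero {p : QPath Q} (hp : p ∈ Z) : pathClass k Z p = 0 :=
  Ideal.Quotient.eq_zero_iff_mem.2
    (TwoSidedIdeal.mem_asIdeal.2 (TwoSidedIdeal.subset_span ⟨p, hp, rfl⟩))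

theorem pathClass_mul (p q : QPath Q) (h : q.tgt = p.src) :
    pathClass k Z p * pathClass k Z q = pathClass k Z (p.comp q h) := by
  rw [pathClass, pathClass, ← map_mul, PathAlgebra.mul_def, PathAlgebra.mulHom_of,
    PathAlgebra.mulPath, dif_pos h, pathClass]

theorem pathClass_mul_of_ne (p q : QPath Q) (h : q.tgt ≠ p.src) :
    pathClass k Z p * pathClass k Z q = 0 := by
  rw [pathClass, pathClass, ← map_mul, PathAlgebra.mul_def, PathAlgebra.mulHom_of,
    PathAlgebra.mulPath, dif_neg h, map_zero]

theorem vertexClass_mul_pathClass (p : QPath Q) :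
    vertexClass k Z p.tgt * pathClass k Z p = pathClass k Z p := by
  rw [vertexClass, pathClass_mul _ _ (by rfl)]
  exact congrArg _ (QPath.idem_comp p _ rfl)

theorem pathClass_mul_vertexClass (p : QPath Q) :
    pathClass k Z p * vertexClass k Z p.src = pathClass k Z p := by
  rw [vertexClass, pathClass_mul _ _ (by rfl)]
  exact congrArg _ (QPath.comp_idem p _ rfl)

theorem vertexClass_mul_self (i : V) :
    vertexClass k Z i * vertexClass k Z i = vertexClass k Z i :=
  vertexClass_mul_pathClass (QPath.idem Q i)

theorem vertexClass_mul_of_ne {i j : V} (h : i ≠ j) :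
    vertexClass k Z i * vertexClass k Z j = 0 :=
  pathClass_mul_of_ne _ _ (Ne.symm h)

variable (k Z) in
theorem sum_vertexClass : ∑ i, vertexClass k Z i = 1 := by
  rw [← map_one (Ideal.Quotient.mk (relIdeal k Z)), PathAlgebra.one_def, map_sum]
  rfl

theorem vertexClass_mul_arrowClass {i j : V} (a : Q.Hom i j) :
    vertexClass k Z j * arrowClass k Z a = arrowClass k Z a :=
  vertexClass_mul_pathClass (QPath.arrow a)

theorem arrowClass_mul_vertexClass {i j : V} (a : Q.Hom i j) :
    arrowClass k Z a * vertexClass k Z i = arrowClass k Z a :=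
  pathClass_mul_vertexClass (QPath.arrow a)

theorem vertexClass_mul_arrowClass_of_ne {i j l : V} (a : Q.Hom i j) (h : l ≠ j) :
    vertexClass k Z l * arrowClass k Z a = 0 :=
  pathClass_mul_of_ne _ _ (Ne.symm h)

theorem arrowClass_mul_vertexClass_of_ne {i j l : V} (a : Q.Hom i j) (h : l ≠ i) :
    arrowClass k Z a * vertexClass k Z l = 0 :=
  pathClass_mul_of_ne _ _ h

theorem pathClass_cons {i j l : V} (p : @Quiver.Path V Q i j) (a : Q.Hom j l) :
    pathClass k Z ⟨i, l, @Quiver.Path.cons V Q _ _ _ p a⟩ =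
      arrowClass k Z a * pathClass k Z ⟨i, j, p⟩ := by
  rw [arrowClass, pathClass_mul _ _ (by rfl)]
  rfl

@[simp]
theorem MonomialAlgebra.lift_pathClass {R : Type*} [Ring R] [Algebra k R] {e : V → R}
    {x : ∀ i j, Q.Hom i j → R} (h : IsQuiverHom e x) (hZ : ∀ z ∈ Z, evalPath e x z.path = 0)
    (p : QPath Q) : lift h hZ (pathClass k Z p) = evalPath e x p.path :=
  PathAlgebra.lift_of h p

/-- Linear maps on a monomial algebra are determined by their values on paths. -/
theorem MonomialAlgebra.linearMap_ext {M : Type*} [AddCommGroup M] [Module k M]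
    {f g : MonomialAlgebra k Z →ₗ[k] M} (h : ∀ p, f (pathClass k Z p) = g (pathClass k Z p)) :
    f = g := by
  have : f.comp (Ideal.Quotient.mkₐ k (relIdeal k Z)).toLinearMap =
      g.comp (Ideal.Quotient.mkₐ k (relIdeal k Z)).toLinearMap := PathAlgebra.hom_ext h
  refine LinearMap.ext fun y => ?_
  obtain ⟨y, rfl⟩ := Ideal.Quotient.mk_surjective y
  exact congr($this y)

/-! ### The length grading -/

theorem pathClass_mem_lengthGrading (p : QPath Q) :
    pathClass k Z p ∈ lengthGrading k Z p.length :=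
  Submodule.subset_span ⟨p, rfl, rfl⟩

theorem vertexClass_mem_lengthGrading (i : V) : vertexClass k Z i ∈ lengthGrading k Z 0 :=
  pathClass_mem_lengthGrading (QPath.idem Q i)

theorem arrowClass_mem_lengthGrading {i j : V} (a : Q.Hom i j) :
    arrowClass k Z a ∈ lengthGrading k Z 1 :=
  pathClass_mem_lengthGrading (QPath.arrow a)

theorem mul_mem_lengthGrading {m n : ℕ} {x y : MonomialAlgebra k Z}
    (hx : x ∈ lengthGrading k Z m) (hy : y ∈ lengthGrading k Z n) :
    x * y ∈ lengthGrading k Z (m + n) := by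
  have : lengthGrading k Z m * lengthGrading k Z n ≤ lengthGrading k Z (m + n) := by
    rw [lengthGrading, lengthGrading, Submodule.span_mul_span, Submodule.span_le]
    rintro _ ⟨_, ⟨p, hp, rfl⟩, _, ⟨q, hq, rfl⟩, rfl⟩
    change pathClass k Z p * pathClass k Z q ∈ lengthGrading k Z (m + n)
    by_cases h : q.tgt = p.src
    · rw [pathClass_mul p q h, ← show p.length = m from hp, ← show q.length = n from hq,
        ← QPath.length_comp p q h]
      exact pathClass_mem_lengthGrading _
    · rw [pathClass_mul_of_ne p q h]
      exact zero_mem _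
  exact this (Submodule.mul_mem_mul hx hy)

end Classes

/-! ### Derivations of monomial algebras that preserve the length -/

section GradedDer

variable {k : Type u} [Field k] {V : Type w} [DecidableEq V] [Fintype V] {Q : Quiver.{v} V}
  {Z : Set (QPath Q)}

/-- Derivations of a monomial algebra are determined by their values on vertices and arrows. -/
theorem derivation_ext {f g : Module.End k (MonomialAlgebra k Z)}
    (hf : f ∈ derivations k (MonomialAlgebra k Z)) (hg : g ∈ derivations k (MonomialAlgebra k Z))
    (hv : ∀ i, f (vertexClass k Z i) = g (vertexClass k Z i))
    (ha : ∀ (i j : V) (a : Q.Hom i j), f (arrowClass k Z a) = g (arrowClass k Z a)) : f = g := by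
  have hf' : ∀ x y, f (x * y) = f x * y + x * f y := hf
  have hg' : ∀ x y, g (x * y) = g x * y + x * g y := hg
  refine MonomialAlgebra.linearMap_ext fun ⟨i, j, p⟩ => ?_
  induction p with
  | nil => exact hv i
  | cons p a ih => rw [pathClass_cons, hf', hg', ih, ha]

variable (k Z) in
/-- The Lie algebra of derivations of a monomial algebra that preserve the path length. -/
def gradedDer : LieSubalgebra k (Module.End k (MonomialAlgebra k Z)) :=
  derivations k (MonomialAlgebra k Z) ⊓ degreePreserving k (lengthGrading k Z)

theorem mem_gradedDer_of {f : Module.End k (MonomialAlgebra k Z)}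
    (hf : f ∈ derivations k (MonomialAlgebra k Z)) (hv : ∀ i, f (vertexClass k Z i) = 0)
    (ha : ∀ (i j : V) (a : Q.Hom i j), f (arrowClass k Z a) ∈ lengthGrading k Z 1) :
    f ∈ gradedDer k Z := by
  have hf' : ∀ x y, f (x * y) = f x * y + x * f y := hf
  refine ⟨hf, fun n x hx => ?_⟩
  have key : ∀ p : QPath Q, f (pathClass k Z p) ∈ lengthGrading k Z p.length := by
    rintro ⟨i, j, p⟩
    induction p with
    | nil => exact (hv i).symm ▸ zero_mem _
    | @cons b c p a ih =>
      have hl : (⟨i, c, @Quiver.Path.cons V Q _ _ _ p a⟩ : QPath Q).length =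
          1 + (⟨i, b, p⟩ : QPath Q).length := Nat.add_comm _ _
      rw [pathClass_cons, hf', hl]
      exact add_mem (mul_mem_lengthGrading (ha _ _ a) (pathClass_mem_lengthGrading _))
        (mul_mem_lengthGrading (arrowClass_mem_lengthGrading a) ih)
  have hle : lengthGrading k Z n ≤ (lengthGrading k Z n).comap f := by
    conv_lhs => rw [lengthGrading]
    rw [Submodule.span_le]
    rintro _ ⟨p, hp, rfl⟩
    exact (show p.length = n from hp) ▸ key p
  exact hle hx

theorem commute_of_mem_lengthGrading_zero {x : MonomialAlgebra k Z}
    (hx : x ∈ lengthGrading k Z 0) (i : V) : vertexClass k Z i * x = x * vertexClass k Z i := by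
  have : lengthGrading k Z 0 ≤ LinearMap.eqLocus (LinearMap.mulLeft k (vertexClass k Z i))
      (LinearMap.mulRight k (vertexClass k Z i)) := by
    rw [lengthGrading, Submodule.span_le]
    rintro _ ⟨p, hp, rfl⟩
    change vertexClass k Z i * pathClass k Z p = pathClass k Z p * vertexClass k Z i
    rw [QPath.eq_idem_of_length hp]
    change vertexClass k Z i * vertexClass k Z p.src = vertexClass k Z p.src * vertexClass k Z i
    by_cases h : i = p.src
    · rw [h]
    · rw [vertexClass_mul_of_ne h, vertexClass_mul_of_ne (Ne.symm h)]
  exact this hx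

theorem gradedDer_apply_vertexClass {f : Module.End k (MonomialAlgebra k Z)}
    (hf : f ∈ gradedDer k Z) (i : V) : f (vertexClass k Z i) = 0 := by
  have hf' : ∀ x y, f (x * y) = f x * y + x * f y := hf.1
  have hc := commute_of_mem_lengthGrading_zero (hf.2 0 _ (vertexClass_mem_lengthGrading i)) i
  have h₁ := hf' (vertexClass k Z i) (vertexClass k Z i)
  rw [vertexClass_mul_self, ← hc] at h₁
  have h₂ : vertexClass k Z i * f (vertexClass k Z i) = 0 := by
    have h₃ := congrArg (vertexClass k Z i * ·) h₁
    simp only [mul_add, ← mul_assoc, vertexClass_mul_self] at h₃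
    simpa using h₃
  rw [h₁, h₂, add_zero]

variable (k Z) in
/-- The span of the classes of the arrows from `i` to `j`. -/
def arrowSpan (i j : V) : Submodule k (MonomialAlgebra k Z) :=
  Submodule.span k (Set.range fun a : Q.Hom i j => arrowClass k Z a)

theorem corner_mem_arrowSpan {x : MonomialAlgebra k Z} (hx : x ∈ lengthGrading k Z 1) (i j : V) :
    vertexClass k Z j * x * vertexClass k Z i ∈ arrowSpan k Z i j := by
  have : lengthGrading k Z 1 ≤ (arrowSpan k Z i j).comap
      ((LinearMap.mulRight k (vertexClass k Z i)).comp
        (LinearMap.mulLeft k (vertexClass k Z j))) := by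
    rw [lengthGrading, Submodule.span_le]
    rintro _ ⟨p, hp, rfl⟩
    obtain ⟨a, ha⟩ := QPath.eq_arrow_of_length hp
    change vertexClass k Z j * pathClass k Z p * vertexClass k Z i ∈ arrowSpan k Z i j
    rw [ha]
    change vertexClass k Z j * arrowClass k Z a * vertexClass k Z i ∈ arrowSpan k Z i j
    obtain ⟨s, t, p⟩ := p
    by_cases hj : j = t
    · subst hj
      rw [vertexClass_mul_arrowClass]
      by_cases hi : i = s
      · subst hi
        rw [arrowClass_mul_vertexClass]
        exact Submodule.subset_span ⟨a, rfl⟩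
      · rw [arrowClass_mul_vertexClass_of_ne _ hi]
        exact zero_mem _
    · rw [vertexClass_mul_arrowClass_of_ne _ hj, zero_mul]
      exact zero_mem _
  exact this hx

theorem gradedDer_apply_arrowClass {f : Module.End k (MonomialAlgebra k Z)}
    (hf : f ∈ gradedDer k Z) {i j : V} (a : Q.Hom i j) :
    f (arrowClass k Z a) ∈ arrowSpan k Z i j := by
  have hf' : ∀ x y, f (x * y) = f x * y + x * f y := hf.1
  have h : f (arrowClass k Z a) =
      vertexClass k Z j * f (arrowClass k Z a) * vertexClass k Z i := by
    conv_lhs => rw [← vertexClass_mul_arrowClass a, ← arrowClass_mul_vertexClass a]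
    rw [hf', hf', gradedDer_apply_vertexClass hf, gradedDer_apply_vertexClass hf]
    simp [mul_assoc]
  rw [h]
  exact corner_mem_arrowSpan (hf.2 1 _ (arrowClass_mem_lengthGrading a)) i j

/-! ### Inner derivations by combinations of vertices -/

variable (k Z) in
/-- The combination of the vertices with given coefficients. -/
def diag : (V → k) →ₗ[k] MonomialAlgebra k Z :=
  ∑ i, (LinearMap.proj i).smulRight (vertexClass k Z i)

theorem diag_apply (c : V → k) : diag k Z c = ∑ i, c i • vertexClass k Z i := by
  simp [diag]

theorem diag_mul_vertexClass (c : V → k) (i : V) :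
    diag k Z c * vertexClass k Z i = c i • vertexClass k Z i := by
  rw [diag_apply, Finset.sum_mul, Finset.sum_eq_single i]
  · rw [smul_mul_assoc, vertexClass_mul_self]
  · intro j _ hj
    rw [smul_mul_assoc, vertexClass_mul_of_ne hj, smul_zero]
  · simp

theorem vertexClass_mul_diag (c : V → k) (i : V) :
    vertexClass k Z i * diag k Z c = c i • vertexClass k Z i := by
  rw [diag_apply, Finset.mul_sum, Finset.sum_eq_single i]
  · rw [mul_smul_comm, vertexClass_mul_self]
  · intro j _ hj
    rw [mul_smul_comm, vertexClass_mul_of_ne (Ne.symm hj), smul_zero]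
  · simp

theorem ad_apply {A : Type*} [Ring A] [Algebra k A] (x y : A) : ad k x y = x * y - y * x := rfl

theorem ad_mem_derivations {A : Type*} [Ring A] [Algebra k A] (x : A) :
    ad k x ∈ derivations k A := by
  intro y z
  simp only [ad_apply, sub_mul, mul_sub, mul_assoc]
  abel

theorem ad_diag_vertexClass (c : V → k) (i : V) :
    ad k (diag k Z c) (vertexClass k Z i) = 0 := by
  rw [ad_apply, diag_mul_vertexClass, vertexClass_mul_diag, sub_self]

theorem ad_diag_arrowClass (c : V → k) {i j : V} (a : Q.Hom i j) :
    ad k (diag k Z c) (arrowClass k Z a) = (c j - c i) • arrowClass k Z a := by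
  have h₁ : diag k Z c * arrowClass k Z a = c j • arrowClass k Z a := by
    rw [← vertexClass_mul_arrowClass a, ← mul_assoc, diag_mul_vertexClass, smul_mul_assoc]
  have h₂ : arrowClass k Z a * diag k Z c = c i • arrowClass k Z a := by
    rw [← arrowClass_mul_vertexClass a, mul_assoc, vertexClass_mul_diag, mul_smul_comm]
  rw [ad_apply, h₁, h₂, sub_smul]

variable (k Z) in
/-- The inner derivation by a combination of vertices. -/
def adDiag : (V → k) →ₗ[k] gradedDer k Z where
  toFun c := ⟨ad k (diag k Z c), mem_gradedDer_of (ad_mem_derivations _) (ad_diag_vertexClass c)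
    fun i j a => by
      rw [ad_diag_arrowClass]
      exact Submodule.smul_mem _ _ (arrowClass_mem_lengthGrading a)⟩
  map_add' c d := Subtype.ext ((congrArg (ad k) (map_add _ c d)).trans (ad_add k _ _))
  map_smul' r c := Subtype.ext ((congrArg (ad k) (map_smul _ r c)).trans (ad_smul k _ _))

theorem lie_adDiag (f : gradedDer k Z) (c : V → k) : ⁅f, adDiag k Z c⁆ = 0 := by
  refine Subtype.ext ((lie_ad k f.2.1 (diag k Z c)).trans ?_)
  rw [diag_apply, map_sum, Finset.sum_eq_zero]
  · rw [← zero_smul k (0 : MonomialAlgebra k Z), ad_smul, zero_smul]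
    rfl
  · intro i _
    rw [map_smul, gradedDer_apply_vertexClass f.2, smul_zero]

/-! ### Coefficients of short paths -/

section Coeff

variable (k) in
/-- The combinations of paths of length at least `n`. -/
def longPaths (Q : Quiver.{v} V) (n : ℕ) : Submodule k (PathAlgebra k Q) :=
  Submodule.span k (PathAlgebra.of k '' {p | n ≤ p.length})

theorem mul_mem_longPaths {m n : ℕ} {x y : PathAlgebra k Q} (hx : x ∈ longPaths k Q m)
    (hy : y ∈ longPaths k Q n) : x * y ∈ longPaths k Q (m + n) := by
  have : longPaths k Q m * longPaths k Q n ≤ longPaths k Q (m + n) := by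
    rw [longPaths, longPaths, Submodule.span_mul_span, Submodule.span_le]
    rintro _ ⟨_, ⟨p, hp, rfl⟩, _, ⟨q, hq, rfl⟩, rfl⟩
    change PathAlgebra.mulHom k Q _ _ ∈ longPaths k Q (m + n)
    rw [PathAlgebra.mulHom_of, PathAlgebra.mulPath]
    split_ifs with h
    · exact Submodule.subset_span
        ⟨_, (add_le_add hp hq).trans (QPath.length_comp p q h).ge, rfl⟩
    · exact zero_mem _
  exact this (Submodule.mul_mem_mul hx hy)

theorem mem_longPaths_zero (x : PathAlgebra k Q) : x ∈ longPaths k Q 0 := by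
  have : (longPaths k Q 0).mkQ = 0 := PathAlgebra.hom_ext fun p => by
    rw [LinearMap.zero_apply, Submodule.mkQ_apply, Submodule.Quotient.mk_eq_zero]
    exact Submodule.subset_span ⟨p, Nat.zero_le _, rfl⟩
  rw [← Submodule.ker_mkQ (longPaths k Q 0), this, LinearMap.ker_zero]
  trivial

theorem mem_longPaths_of_mem_relIdeal {n : ℕ} (hZ : ∀ z ∈ Z, n ≤ z.length) {x : PathAlgebra k Q}
    (hx : x ∈ relIdeal k Z) : x ∈ longPaths k Q n := by
  have := relIdeal_le_of_mem (TwoSidedIdeal.mk' (longPaths k Q n : Set (PathAlgebra k Q))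
    (zero_mem _) add_mem neg_mem
    (fun {x y} hy => by
      have := mul_mem_longPaths (mem_longPaths_zero x) hy
      rwa [Nat.zero_add] at this)
    (fun {x y} hx => by
      have := mul_mem_longPaths hx (mem_longPaths_zero y)
      rwa [Nat.add_zero] at this))
    (fun z hz => by
      rw [TwoSidedIdeal.mem_mk']
      exact Submodule.subset_span ⟨z, hZ z hz, rfl⟩) hx
  rwa [TwoSidedIdeal.mem_mk'] at this

open Classical in
variable (k) in
/-- If all relations have length at least two, then there are coefficients of the vertices and
of the arrows. -/
theorem exists_coeff (hZ : ∀ z ∈ Z, 2 ≤ z.length) (p : QPath Q) (hp : p.length < 2) :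
    ∃ t : MonomialAlgebra k Z →ₗ[k] k, ∀ q, t (pathClass k Z q) = if q = p then 1 else 0 := by
  obtain ⟨σ, hσ⟩ := LinearMap.exists_rightInverse_of_surjective
    (Ideal.Quotient.mkₐ k (relIdeal k Z)).toLinearMap
    (LinearMap.range_eq_top.2 (Ideal.Quotient.mkₐ_surjective k _))
  let t : PathAlgebra k Q →ₗ[k] k := PathAlgebra.extend k fun q => if q = p then 1 else 0
  refine ⟨t.comp σ, fun q => ?_⟩
  have hσq : σ (pathClass k Z q) - PathAlgebra.of k q ∈ longPaths k Q 2 := by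
    refine mem_longPaths_of_mem_relIdeal hZ ?_
    rw [← Ideal.Quotient.eq_zero_iff_mem, map_sub, sub_eq_zero]
    exact congr($hσ (pathClass k Z q))
  have ht : longPaths k Q 2 ≤ LinearMap.ker t := by
    rw [longPaths, Submodule.span_le]
    rintro _ ⟨q, hq, rfl⟩
    change t (PathAlgebra.of k q) = 0
    rw [PathAlgebra.extend_of, if_neg]
    rintro rfl
    exact absurd hp (not_lt.2 hq)
  have h := ht hσq
  rw [LinearMap.mem_ker, map_sub, sub_eq_zero, PathAlgebra.extend_of] at h
  exact h

variable (k) in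
/-- The coefficient of a vertex. -/
def vertexCoeff (hZ : ∀ z ∈ Z, 2 ≤ z.length) (i : V) : MonomialAlgebra k Z →ₗ[k] k :=
  (exists_coeff k hZ (QPath.idem Q i) (Nat.zero_lt_two)).choose

variable (k) in
/-- The coefficient of an arrow. -/
def arrowCoeff (hZ : ∀ z ∈ Z, 2 ≤ z.length) {i j : V} (a : Q.Hom i j) :
    MonomialAlgebra k Z →ₗ[k] k :=
  (exists_coeff k hZ (QPath.arrow a) (Nat.one_lt_two)).choose

variable (hZ : ∀ z ∈ Z, 2 ≤ z.length)

theorem vertexCoeff_vertexClass (i j : V) :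
    vertexCoeff k hZ i (vertexClass k Z j) = if j = i then 1 else 0 := by
  classical
  refine ((exists_coeff k hZ (QPath.idem Q i) (Nat.zero_lt_two)).choose_spec _).trans ?_
  refine if_congr ⟨fun h => congrArg QPath.src h, fun h => h ▸ rfl⟩ rfl rfl

theorem vertexCoeff_pathClass (i : V) {p : QPath Q} (hp : p.length ≠ 0) :
    vertexCoeff k hZ i (pathClass k Z p) = 0 := by
  classical
  refine ((exists_coeff k hZ (QPath.idem Q i) (Nat.zero_lt_two)).choose_spec _).trans (if_neg ?_)
  rintro rfl
  exact hp rfl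

theorem arrowCoeff_arrowClass {i j : V} [DecidableEq (Q.Hom i j)] (a b : Q.Hom i j) :
    arrowCoeff k hZ a (arrowClass k Z b) = if b = a then 1 else 0 := by
  classical
  refine ((exists_coeff k hZ (QPath.arrow a) (Nat.one_lt_two)).choose_spec _).trans ?_
  exact if_congr ⟨fun h => QPath.arrow_injective h, fun h => h ▸ rfl⟩ rfl rfl

theorem arrowCoeff_pathClass {i j : V} (a : Q.Hom i j) {p : QPath Q} (hp : p.length ≠ 1) :
    arrowCoeff k hZ a (pathClass k Z p) = 0 := by
  classical
  refine ((exists_coeff k hZ (QPath.arrow a) (Nat.one_lt_two)).choose_spec _).trans (if_neg ?_)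
  rintro rfl
  exact hp rfl

theorem eq_sum_arrowCoeff {i j : V} [Fintype (Q.Hom i j)] {x : MonomialAlgebra k Z}
    (hx : x ∈ arrowSpan k Z i j) :
    x = ∑ a : Q.Hom i j, arrowCoeff k hZ a x • arrowClass k Z a := by
  classical
  have : arrowSpan k Z i j ≤ LinearMap.eqLocus LinearMap.id
      (∑ a : Q.Hom i j, (arrowCoeff k hZ a).smulRight (arrowClass k Z a)) := by
    rw [arrowSpan, Submodule.span_le]
    rintro _ ⟨b, rfl⟩
    simp [LinearMap.mem_eqLocus, arrowCoeff_arrowClass]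
  simpa [LinearMap.mem_eqLocus] using this hx

include hZ in
/-- An inner derivation that preserves the length is given by a combination of vertices. -/
theorem exists_adDiag_eq [∀ i j, Fintype (Q.Hom i j)] (f : gradedDer k Z)
    (hf : ∃ x, (f : Module.End k (MonomialAlgebra k Z)) = ad k x) : ∃ c, f = adDiag k Z c := by
  obtain ⟨x, hx⟩ := hf
  let c : V → k := fun i => vertexCoeff k hZ i x
  refine ⟨c, ?_⟩
  let S : Submodule k (MonomialAlgebra k Z) :=
    Submodule.span k (pathClass k Z '' {p | p.length ≠ 0})
  have hS : x - diag k Z c ∈ S := by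
    have : S.mkQ.comp (LinearMap.id - (diag k Z).comp (LinearMap.pi (vertexCoeff k hZ))) = 0 := by
      refine MonomialAlgebra.linearMap_ext fun p => ?_
      rw [LinearMap.zero_apply, LinearMap.comp_apply, Submodule.mkQ_apply,
        Submodule.Quotient.mk_eq_zero, LinearMap.sub_apply, LinearMap.comp_apply,
        LinearMap.id_apply, diag_apply]
      simp only [LinearMap.pi_apply]
      by_cases hp : p.length = 0
      · rw [QPath.eq_idem_of_length hp]
        change vertexClass k Z p.src - ∑ i, vertexCoeff k hZ i (vertexClass k Z p.src) • _ ∈ S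
        simp [vertexCoeff_vertexClass]
      · simp only [vertexCoeff_pathClass hZ _ hp, zero_smul, Finset.sum_const_zero, sub_zero]
        exact Submodule.subset_span ⟨p, hp, rfl⟩
    have h := congr($this x)
    rwa [LinearMap.zero_apply, LinearMap.comp_apply, Submodule.mkQ_apply,
        Submodule.Quotient.mk_eq_zero] at h
  have hcoeff : ∀ {i j : V} (a b : Q.Hom i j), arrowCoeff k hZ a
      (ad k (x - diag k Z c) (arrowClass k Z b)) = 0 := by
    intro i j a b
    have : S ≤ LinearMap.ker ((arrowCoeff k hZ a).comp
        (LinearMap.mulRight k (arrowClass k Z b) - LinearMap.mulLeft k (arrowClass k Z b))) := by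
      rw [Submodule.span_le]
      rintro _ ⟨p, hp, rfl⟩
      have h₁ : arrowCoeff k hZ a (pathClass k Z p * arrowClass k Z b) = 0 := by
        by_cases h : (QPath.arrow b).tgt = p.src
        · rw [arrowClass, pathClass_mul _ _ h]
          refine arrowCoeff_pathClass hZ a ?_
          rw [QPath.length_comp]
          exact fun h' => hp (Nat.succ_injective h')
        · rw [arrowClass, pathClass_mul_of_ne _ _ h, map_zero]
      have h₂ : arrowCoeff k hZ a (arrowClass k Z b * pathClass k Z p) = 0 := by
        by_cases h : p.tgt = (QPath.arrow b).src
        · rw [arrowClass, pathClass_mul _ _ h]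
          refine arrowCoeff_pathClass hZ a ?_
          rw [QPath.length_comp, Nat.add_comm]
          exact fun h' => hp (Nat.succ_injective h')
        · rw [arrowClass, pathClass_mul_of_ne _ _ h, map_zero]
      change arrowCoeff k hZ a (pathClass k Z p * arrowClass k Z b -
        arrowClass k Z b * pathClass k Z p) = 0
      rw [map_sub, h₁, h₂, sub_zero]
    exact this hS
  have hd : ((f - adDiag k Z c : gradedDer k Z) : Module.End k (MonomialAlgebra k Z)) =
      ad k (x - diag k Z c) := by
    rw [sub_eq_add_neg x, ad_add, ← neg_one_smul k (diag k Z c), ad_smul, neg_one_smul,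
      ← sub_eq_add_neg, ← hx]
    rfl
  rw [← sub_eq_zero]
  have hm := (f - adDiag k Z c).2
  refine Subtype.ext (derivation_ext hm.1 (zero_mem _)
    (fun i => gradedDer_apply_vertexClass hm i) fun i j b => ?_)
  rw [eq_sum_arrowCoeff hZ (gradedDer_apply_arrowClass hm b)]
  refine Finset.sum_eq_zero fun a _ => ?_
  rw [hd, hcoeff, zero_smul]

/-! ### Traces -/

variable [∀ i j, Fintype (Q.Hom i j)]

/-- The trace of a derivation that preserves the length on the span of the arrows from `i`
to `j`. -/
def arrowTrace (ij : V × V) : gradedDer k Z →ₗ[k] k where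
  toFun f := ∑ a : Q.Hom ij.1 ij.2,
    arrowCoeff k hZ a ((f : Module.End k (MonomialAlgebra k Z)) (arrowClass k Z a))
  map_add' f g := by
    rw [← Finset.sum_add_distrib]
    exact Finset.sum_congr rfl fun a _ => map_add _ _ _
  map_smul' r f := by
    rw [RingHom.id_apply, Finset.smul_sum]
    exact Finset.sum_congr rfl fun a _ => map_smul (arrowCoeff k hZ a) r _

theorem arrowTrace_lie (ij : V × V) (f g : gradedDer k Z) : arrowTrace hZ ij ⁅f, g⁆ = 0 := by
  have key : ∀ f g : gradedDer k Z, ∑ a : Q.Hom ij.1 ij.2, arrowCoeff k hZ a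
      ((f : Module.End k (MonomialAlgebra k Z))
        ((g : Module.End k (MonomialAlgebra k Z)) (arrowClass k Z a))) =
      ∑ a : Q.Hom ij.1 ij.2, ∑ b : Q.Hom ij.1 ij.2,
        arrowCoeff k hZ b ((g : Module.End k (MonomialAlgebra k Z)) (arrowClass k Z a)) *
        arrowCoeff k hZ a ((f : Module.End k (MonomialAlgebra k Z)) (arrowClass k Z b)) := by
    intro f g
    refine Finset.sum_congr rfl fun a _ => ?_
    conv_lhs => rw [eq_sum_arrowCoeff hZ (gradedDer_apply_arrowClass g.2 a)]
    simp only [map_sum, map_smul, smul_eq_mul]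
  change ∑ a : Q.Hom ij.1 ij.2, arrowCoeff k hZ a (_ - _) = 0
  simp only [map_sub, Finset.sum_sub_distrib]
  rw [sub_eq_zero]
  refine (key f g).trans (Eq.trans ?_ (key g f).symm)
  rw [Finset.sum_comm]
  exact Finset.sum_congr rfl fun a _ => Finset.sum_congr rfl fun b _ => mul_comm _ _

theorem arrowTrace_adDiag (ij : V × V) (c : V → k) :
    arrowTrace hZ ij (adDiag k Z c) = Fintype.card (Q.Hom ij.1 ij.2) * (c ij.2 - c ij.1) := by
  classical
  change ∑ a : Q.Hom ij.1 ij.2, arrowCoeff k hZ a (ad k (diag k Z c) (arrowClass k Z a)) = _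
  simp [ad_diag_arrowClass, arrowCoeff_arrowClass, mul_sub]

include hZ in
/-- In characteristic zero, the inner derivations by combinations of vertices have a complement
that contains all commutators. -/
theorem exists_retraction_adDiag [CharZero k] : ∃ φ : gradedDer k Z →ₗ[k] (V → k),
    (∀ f g : gradedDer k Z, φ ⁅f, g⁆ = 0) ∧ ∀ c, adDiag k Z (φ (adDiag k Z c)) = adDiag k Z c := by
  let T : gradedDer k Z →ₗ[k] (V × V → k) := LinearMap.pi (arrowTrace hZ)
  let K : (V → k) →ₗ[k] (V × V → k) := T.comp (adDiag k Z)
  obtain ⟨S₀, hS₀⟩ := LinearMap.exists_rightInverse_of_surjective K.rangeRestrict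
    K.range_rangeRestrict
  obtain ⟨S, hS⟩ := LinearMap.exists_extend S₀
  refine ⟨S.comp T, fun f g => ?_, fun c => ?_⟩
  · have : T ⁅f, g⁆ = 0 := funext fun ij => arrowTrace_lie hZ ij f g
    rw [LinearMap.comp_apply, this, map_zero]
  · have hK : K (S (K c)) = K c := by
      have h₁ : S (K c) = S₀ (K.rangeRestrict c) := congr($hS (K.rangeRestrict c))
      rw [h₁]
      exact congr(($hS₀ (K.rangeRestrict c) : V × V → k))
    rw [← sub_eq_zero, ← map_sub] at hK ⊢
    set d := S (K c) - c
    change adDiag k Z d = 0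
    refine Subtype.ext (derivation_ext (adDiag k Z d).2.1 (zero_mem _) (ad_diag_vertexClass d)
      fun i j a => ?_)
    have h : arrowTrace hZ (i, j) (adDiag k Z d) = 0 := congr($hK (i, j))
    rw [arrowTrace_adDiag, mul_eq_zero, Nat.cast_eq_zero] at h
    refine (ad_diag_arrowClass d a).trans ?_
    have : Nonempty (Q.Hom i j) := ⟨a⟩
    rw [h.resolve_left Fintype.card_ne_zero, zero_smul]
    rfl

end Coeff

end GradedDer

/-! ### The dual extension as a split extension of `B` -/

section Borel

variable {k : Type u} [Field k] {V : Type w} [DecidableEq V] [Fintype V] {QB QA : Quiver.{v} V}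
  {ZB : Set (QPath QB)} {ZA : Set (QPath QA)}

theorem borelHom_pathClass (p : QPath QB) : borelHom k ZB ZA (pathClass k ZB p) =
    pathClass k (dualRelations ZB ZA) (p.map (inclArrow QB QA)) :=
  congrArg (Ideal.Quotient.mk (relIdeal k (dualRelations ZB ZA)))
    (PathAlgebra.map_of (inclArrow QB QA) p)

theorem borelHom_vertexClass (i : V) : borelHom k ZB ZA (vertexClass k ZB i) =
    vertexClass k (dualRelations ZB ZA) i :=
  borelHom_pathClass _

theorem borelHom_arrowClass {i j : V} (a : QB.Hom i j) : borelHom k ZB ZA (arrowClass k ZB a) =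
    arrowClass k (dualRelations ZB ZA) (inclArrow QB QA i j a) :=
  borelHom_pathClass _

variable (k ZB QA) in
/-- The values of the arrows of the dual extension under the projection to `B`. -/
def borelProjArrow (i j : V) : (dualQuiver QB QA).Hom i j → MonomialAlgebra k ZB :=
  Sum.elim (fun b => arrowClass k ZB b) (fun _ => 0)

theorem isQuiverHom_borelProj : IsQuiverHom (Q := dualQuiver QB QA) (vertexClass k ZB)
    (borelProjArrow k QA ZB) where
  idem := vertexClass_mul_self
  ortho _ _ := vertexClass_mul_of_ne
  sum := sum_vertexClass k ZB
  left := by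
    rintro i j (b | a)
    · exact vertexClass_mul_arrowClass b
    · exact mul_zero _
  right := by
    rintro i j (b | a)
    · exact arrowClass_mul_vertexClass b
    · exact zero_mul _

theorem evalPath_borelProj_map {i j : V} (p : @Quiver.Path V QB i j) :
    evalPath (Q := dualQuiver QB QA) (vertexClass k ZB) (borelProjArrow k QA ZB)
      (QPath.map (inclArrow QB QA) ⟨i, j, p⟩).path = pathClass k ZB ⟨i, j, p⟩ := by
  induction p with
  | nil => rfl
  | cons p a ih =>
    rw [pathClass_cons, ← ih]
    rfl

theorem evalPath_borelProj_opPath {p : QPath QA} (hp : p.length ≠ 0) :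
    evalPath (Q := dualQuiver QB QA) (vertexClass k ZB) (borelProjArrow k QA ZB)
      (opPath QB QA p).path = 0 := by
  obtain ⟨i, j, p⟩ := p
  cases p with
  | nil => exact absurd rfl hp
  | cons p a =>
    refine (isQuiverHom_borelProj.evalPath_comp _ _).trans ?_
    refine (congrArg (_ * ·) (isQuiverHom_borelProj.evalPath_toPath _)).trans ?_
    exact mul_zero _

/-- The projection from the dual extension to `B` which kills the arrows of `A`. -/
def borelProj (hZA : ∀ z ∈ ZA, 2 ≤ z.length) : DualExtension k ZB ZA →ₐ[k] MonomialAlgebra k ZB :=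
  MonomialAlgebra.lift isQuiverHom_borelProj (by
    rintro z ((⟨p, hp, rfl⟩ | ⟨p, hp, rfl⟩) | ⟨i, j, l, β, α, rfl⟩)
    · exact (evalPath_borelProj_map p.path).trans (pathClass_eq_zero hp)
    · exact evalPath_borelProj_opPath (Nat.ne_of_gt (zero_lt_two.trans_le (hZA p hp)))
    · refine (isQuiverHom_borelProj.evalPath_comp _ _).trans ?_
      refine (congrArg (_ * ·) (isQuiverHom_borelProj.evalPath_toPath _)).trans ?_
      exact mul_zero _)

variable (hZA : ∀ z ∈ ZA, 2 ≤ z.length)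

theorem borelProj_borelHom (b : MonomialAlgebra k ZB) :
    borelProj hZA (borelHom k ZB ZA b) = b := by
  have : (borelProj hZA).toLinearMap.comp (borelHom k ZB ZA).toLinearMap = LinearMap.id :=
    MonomialAlgebra.linearMap_ext fun p => by
      change borelProj hZA (borelHom k ZB ZA (pathClass k ZB p)) = _
      rw [borelHom_pathClass, borelProj, MonomialAlgebra.lift_pathClass]
      exact evalPath_borelProj_map p.path
  exact congr($this b)

theorem borelHom_borelProj_of_mem_arrowSpan {i j : V} (hij : QA.Hom j i → False)
    {x : DualExtension k ZB ZA} (hx : x ∈ arrowSpan k (dualRelations ZB ZA) i j) :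
    borelHom k ZB ZA (borelProj hZA x) = x := by
  have : arrowSpan k (dualRelations ZB ZA) i j ≤ LinearMap.eqLocus
      ((borelHom k ZB ZA).toLinearMap.comp (borelProj hZA).toLinearMap) LinearMap.id := by
    rw [arrowSpan, Submodule.span_le]
    rintro _ ⟨b | a, rfl⟩
    · change borelHom k ZB ZA (borelProj hZA (arrowClass k (dualRelations ZB ZA)
        (inclArrow QB QA i j b))) = arrowClass k (dualRelations ZB ZA) (inclArrow QB QA i j b)
      rw [← borelHom_arrowClass, borelProj_borelHom]
    · exact (hij a).elim
  exact this hx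

/-! ### Restriction of derivations to `B` -/

/-- A derivation that preserves the length maps `B` to itself. -/
theorem borelHom_borelProj_gradedDer (hdir : ∀ i j, QB.Hom i j → QA.Hom j i → False)
    {f : Module.End k (DualExtension k ZB ZA)} (hf : f ∈ gradedDer k (dualRelations ZB ZA))
    (b : MonomialAlgebra k ZB) :
    borelHom k ZB ZA (borelProj hZA (f (borelHom k ZB ZA b))) = f (borelHom k ZB ZA b) := by
  have hf' : ∀ x y, f (x * y) = f x * y + x * f y := hf.1
  have : (borelHom k ZB ZA).toLinearMap.comp ((borelProj hZA).toLinearMap.comp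
      (f.comp (borelHom k ZB ZA).toLinearMap)) = f.comp (borelHom k ZB ZA).toLinearMap := by
    refine MonomialAlgebra.linearMap_ext fun ⟨i, j, p⟩ => ?_
    change borelHom k ZB ZA (borelProj hZA (f (borelHom k ZB ZA (pathClass k ZB _)))) =
      f (borelHom k ZB ZA (pathClass k ZB _))
    induction p with
    | nil =>
      have : f (borelHom k ZB ZA (vertexClass k ZB i)) = 0 := by
        rw [borelHom_vertexClass, gradedDer_apply_vertexClass hf]
      change borelHom k ZB ZA (borelProj hZA (f (borelHom k ZB ZA (vertexClass k ZB i)))) =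
        f (borelHom k ZB ZA (vertexClass k ZB i))
      rw [this, map_zero, map_zero]
    | cons p a ih =>
      rw [pathClass_cons, map_mul, hf', map_add, map_mul, map_mul, map_add, map_mul, map_mul, ih,
        borelProj_borelHom, borelProj_borelHom]
      congr 2
      rw [borelHom_arrowClass]
      exact borelHom_borelProj_of_mem_arrowSpan hZA (hdir _ _ a) (gradedDer_apply_arrowClass hf _)
  exact congr($this b)

/-- The restriction of derivations of the dual extension that preserve the length to `B`. -/
def restrictBorel (hdir : ∀ i j, QB.Hom i j → QA.Hom j i → False) :
    gradedDer k (dualRelations ZB ZA) →ₗ⁅k⁆ gradedDer k ZB where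
  toFun f := ⟨(borelProj hZA).toLinearMap.comp
      ((f : Module.End k (DualExtension k ZB ZA)).comp (borelHom k ZB ZA).toLinearMap), by
    have hf' : ∀ x y, f.1 (x * y) = f.1 x * y + x * f.1 y := f.2.1
    refine mem_gradedDer_of ?_ ?_ ?_
    · intro x y
      simp only [LinearMap.comp_apply, AlgHom.toLinearMap_apply, map_mul, hf', map_add,
        borelProj_borelHom]
    · intro i
      simp only [LinearMap.comp_apply, AlgHom.toLinearMap_apply, borelHom_vertexClass,
        gradedDer_apply_vertexClass f.2, map_zero]
    · intro i j a
      simp only [LinearMap.comp_apply, AlgHom.toLinearMap_apply, borelHom_arrowClass]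
      have h := gradedDer_apply_arrowClass f.2 (inclArrow QB QA i j a)
      have hle : arrowSpan k (dualRelations ZB ZA) i j ≤
          (lengthGrading k ZB 1).comap (borelProj hZA).toLinearMap := by
        rw [arrowSpan, Submodule.span_le]
        rintro _ ⟨b | a', rfl⟩
        · change borelProj hZA (arrowClass k (dualRelations ZB ZA) (inclArrow QB QA i j b)) ∈
            lengthGrading k ZB 1
          rw [← borelHom_arrowClass, borelProj_borelHom]
          exact arrowClass_mem_lengthGrading b
        · exact (hdir i j a a').elim
      exact hle h⟩
  map_add' f g := Subtype.ext (LinearMap.ext fun b => map_add (borelProj hZA) _ _)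
  map_smul' r f := Subtype.ext (LinearMap.ext fun b => map_smul (borelProj hZA) r _)
  map_lie' := by
    intro f g
    refine Subtype.ext (LinearMap.ext fun b => ?_)
    change borelProj hZA (f.1 (g.1 (borelHom k ZB ZA b)) - g.1 (f.1 (borelHom k ZB ZA b))) =
      borelProj hZA (f.1 (borelHom k ZB ZA (borelProj hZA (g.1 (borelHom k ZB ZA b))))) -
        borelProj hZA (g.1 (borelHom k ZB ZA (borelProj hZA (f.1 (borelHom k ZB ZA b)))))
    rw [borelHom_borelProj_gradedDer hZA hdir g.2, borelHom_borelProj_gradedDer hZA hdir f.2,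
      map_sub]

theorem borelHom_restrictBorel (hdir : ∀ i j, QB.Hom i j → QA.Hom j i → False)
    (f : gradedDer k (dualRelations ZB ZA)) (b : MonomialAlgebra k ZB) :
    borelHom k ZB ZA ((restrictBorel hZA hdir f).1 b) = f.1 (borelHom k ZB ZA b) :=
  borelHom_borelProj_gradedDer hZA hdir f.2 b

/-! ### Extension of derivations from `B` -/

section Extension

theorem trivSqZeroExt_mul {R : Type*} [Ring R] (a b x y : R) :
    (TrivSqZeroExt.inl a + TrivSqZeroExt.inr x : TrivSqZeroExt R R) *
      (TrivSqZeroExt.inl b + TrivSqZeroExt.inr y) =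
      TrivSqZeroExt.inl (a * b) + TrivSqZeroExt.inr (x * b + a * y) := by
  ext
  · simp
  · simp [add_comm]

variable (ZA) (g : Module.End k (MonomialAlgebra k ZB))

/-- The values of the vertices in the dual numbers over the dual extension. -/
def dualVertex (ZB : Set (QPath QB)) (i : V) :
    TrivSqZeroExt (DualExtension k ZB ZA) (DualExtension k ZB ZA) :=
  TrivSqZeroExt.inl (vertexClass k (dualRelations ZB ZA) i)

/-- The values of the arrows in the dual numbers over the dual extension, for the infinitesimal
automorphism given by a derivation of `B`. -/
def dualArrow (i j : V) : (dualQuiver QB QA).Hom i j →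
    TrivSqZeroExt (DualExtension k ZB ZA) (DualExtension k ZB ZA) :=
  Sum.elim
    (fun b => TrivSqZeroExt.inl (arrowClass k (dualRelations ZB ZA) (inclArrow QB QA i j b)) +
      TrivSqZeroExt.inr (borelHom k ZB ZA (g (arrowClass k ZB b))))
    (fun a => TrivSqZeroExt.inl (arrowClass k (dualRelations ZB ZA) (opArrow QB QA j i a)))

variable {g} (hg : g ∈ gradedDer k ZB)
include hg

theorem isQuiverHom_dual :
    IsQuiverHom (Q := dualQuiver QB QA) (dualVertex (k := k) ZA ZB) (dualArrow ZA g) := by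
  have hg' : ∀ x y, g (x * y) = g x * y + x * g y := hg.1
  refine ⟨fun i => ?_, fun i j h => ?_, ?_, ?_, ?_⟩
  · rw [dualVertex, ← TrivSqZeroExt.inl_mul, vertexClass_mul_self]
  · rw [dualVertex, dualVertex, ← TrivSqZeroExt.inl_mul, vertexClass_mul_of_ne h,
      TrivSqZeroExt.inl_zero]
  · simp only [dualVertex]
    rw [← TrivSqZeroExt.inl_sum, sum_vertexClass, TrivSqZeroExt.inl_one]
  · rintro i j (b | a)
    · simp only [dualVertex, dualArrow, Sum.elim_inl, mul_add, ← TrivSqZeroExt.inl_mul,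
        TrivSqZeroExt.inl_mul_inr, vertexClass_mul_arrowClass, smul_eq_mul]
      rw [← borelHom_vertexClass, ← map_mul, ← zero_add (_ * g _),
        ← zero_mul (arrowClass k ZB b), ← gradedDer_apply_vertexClass hg j, ← hg',
        vertexClass_mul_arrowClass]
    · simp only [dualVertex, dualArrow, Sum.elim_inr, ← TrivSqZeroExt.inl_mul,
        vertexClass_mul_arrowClass]
  · rintro i j (b | a)
    · simp only [dualVertex, dualArrow, Sum.elim_inl, add_mul, ← TrivSqZeroExt.inl_mul,
        TrivSqZeroExt.inr_mul_inl, arrowClass_mul_vertexClass, MulOpposite.smul_eq_mul_unop,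
        MulOpposite.unop_op]
      rw [← borelHom_vertexClass, ← map_mul, ← add_zero (g _ * _),
        ← mul_zero (arrowClass k ZB b), ← gradedDer_apply_vertexClass hg i, ← hg',
        arrowClass_mul_vertexClass]
    · simp only [dualVertex, dualArrow, Sum.elim_inr, ← TrivSqZeroExt.inl_mul,
        arrowClass_mul_vertexClass]

omit hg in
theorem fst_evalPath_dual {i j : V} (p : @Quiver.Path V (dualQuiver QB QA) i j) :
    (evalPath (dualVertex (k := k) ZA ZB) (dualArrow ZA g) p).fst =
      pathClass k (dualRelations ZB ZA) ⟨i, j, p⟩ := by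
  induction p with
  | nil => rfl
  | cons p a ih =>
    rw [pathClass_cons, evalPath, TrivSqZeroExt.fst_mul, ih]
    congr 1
    rcases a with b | a
    · exact add_zero _
    · rfl

theorem evalPath_dual_map {i j : V} (p : @Quiver.Path V QB i j) :
    evalPath (dualVertex (k := k) ZA ZB) (dualArrow ZA g)
      (QPath.map (inclArrow QB QA) ⟨i, j, p⟩).path =
      TrivSqZeroExt.inl (borelHom k ZB ZA (pathClass k ZB ⟨i, j, p⟩)) +
        TrivSqZeroExt.inr (borelHom k ZB ZA (g (pathClass k ZB ⟨i, j, p⟩))) := by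
  have hg' : ∀ x y, g (x * y) = g x * y + x * g y := hg.1
  induction p with
  | nil =>
    change dualVertex ZA ZB i = TrivSqZeroExt.inl (borelHom k ZB ZA (vertexClass k ZB i)) +
        TrivSqZeroExt.inr (borelHom k ZB ZA (g (vertexClass k ZB i)))
    rw [gradedDer_apply_vertexClass hg, map_zero, TrivSqZeroExt.inr_zero, add_zero,
      borelHom_vertexClass]
    rfl
  | cons p a ih =>
    refine (congrArg (dualArrow ZA g _ _ (inclArrow QB QA _ _ a) * ·) ih).trans ?_
    rw [pathClass_cons, hg']
    change (TrivSqZeroExt.inl _ + TrivSqZeroExt.inr _) * _ = _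
    rw [← borelHom_arrowClass, trivSqZeroExt_mul]
    simp only [map_add, map_mul]

theorem snd_evalPath_dual_op {i j : V} (p : @Quiver.Path V QA i j) :
    (evalPath (dualVertex (k := k) ZA ZB) (dualArrow ZA g) (opPathAux QB QA p)).snd = 0 := by
  induction p with
  | nil => rfl
  | cons p a ih =>
    rw [opPathAux, (isQuiverHom_dual ZA hg).evalPath_comp,
      (isQuiverHom_dual ZA hg).evalPath_toPath, TrivSqZeroExt.snd_mul, ih]
    simp [dualArrow, opArrow]

omit hg in
theorem borelHom_mul_opArrow {i j l : V} {x : MonomialAlgebra k ZB}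
    (hx : x ∈ arrowSpan k ZB j l) (a : QA.Hom j i) :
    borelHom k ZB ZA x * arrowClass k (dualRelations ZB ZA) (opArrow QB QA j i a) = 0 := by
  have : arrowSpan k ZB j l ≤ LinearMap.ker ((LinearMap.mulRight k
      (arrowClass k (dualRelations ZB ZA) (opArrow QB QA j i a))).comp
        (borelHom k ZB ZA).toLinearMap) := by
    rw [arrowSpan, Submodule.span_le]
    rintro _ ⟨b, rfl⟩
    change borelHom k ZB ZA (arrowClass k ZB b) *
      arrowClass k (dualRelations ZB ZA) (opArrow QB QA j i a) = 0
    rw [borelHom_arrowClass, arrowClass, arrowClass, pathClass_mul _ _ (by rfl)]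
    exact pathClass_eq_zero (Or.inr ⟨i, j, l, a, b, rfl⟩)
  exact this hx

theorem evalPath_dual_eq_zero {z : QPath (dualQuiver QB QA)} (hz : z ∈ dualRelations ZB ZA) :
    evalPath (dualVertex (k := k) ZA ZB) (dualArrow ZA g) z.path = 0 := by
  refine TrivSqZeroExt.ext ((fst_evalPath_dual ZA z.path).trans (pathClass_eq_zero hz)) ?_
  rcases hz with (⟨p, hp, rfl⟩ | ⟨p, hp, rfl⟩) | ⟨i, j, l, β, α, rfl⟩
  · refine (congrArg TrivSqZeroExt.snd (evalPath_dual_map ZA hg p.path)).trans ?_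
    rw [show pathClass k ZB ⟨p.src, p.tgt, p.path⟩ = 0 from pathClass_eq_zero hp]
    simp
  · exact snd_evalPath_dual_op ZA hg p.path
  · have h := isQuiverHom_dual ZA hg (QA := QA)
    refine (congrArg TrivSqZeroExt.snd ((h.evalPath_comp _ _).trans
      (congrArg₂ (· * ·) (h.evalPath_toPath _) (h.evalPath_toPath _)))).trans ?_
    change ((TrivSqZeroExt.inl _ + TrivSqZeroExt.inr (borelHom k ZB ZA (g (arrowClass k ZB α)))) *
      TrivSqZeroExt.inl (arrowClass k (dualRelations ZB ZA) (opArrow QB QA j i β)) :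
        TrivSqZeroExt (DualExtension k ZB ZA) (DualExtension k ZB ZA)).snd = 0
    rw [← add_zero (TrivSqZeroExt.inl (arrowClass k (dualRelations ZB ZA) (opArrow QB QA j i β))),
      ← TrivSqZeroExt.inr_zero, trivSqZeroExt_mul, TrivSqZeroExt.snd_add, TrivSqZeroExt.snd_inl,
      TrivSqZeroExt.snd_inr, borelHom_mul_opArrow ZA (gradedDer_apply_arrowClass hg α) β,
      mul_zero, add_zero, add_zero]

/-- A derivation of `B` that preserves the length extends to the dual extension, by zero on the
arrows of `A`. -/
theorem exists_extension : ∃ f : gradedDer k (dualRelations ZB ZA),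
    (∀ b, f.1 (borelHom k ZB ZA b) = borelHom k ZB ZA (g b)) ∧
      ∀ (i j : V) (a : QA.Hom i j),
        f.1 (arrowClass k (dualRelations ZB ZA) (opArrow QB QA i j a)) = 0 := by
  have h := isQuiverHom_dual ZA hg (QA := QA)
  have hZ : ∀ z ∈ dualRelations ZB ZA,
      evalPath (dualVertex (k := k) ZA ZB) (dualArrow ZA g) z.path = 0 :=
    fun z hz => evalPath_dual_eq_zero ZA hg hz
  let Φ : DualExtension k ZB ZA →ₐ[k]
      TrivSqZeroExt (DualExtension k ZB ZA) (DualExtension k ZB ZA) :=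
    MonomialAlgebra.lift h hZ
  have hfst : ∀ x, (Φ x).fst = x := by
    have : (TrivSqZeroExt.fstHom k (DualExtension k ZB ZA)
        (DualExtension k ZB ZA)).toLinearMap.comp Φ.toLinearMap = LinearMap.id :=
      MonomialAlgebra.linearMap_ext fun p =>
        (congrArg TrivSqZeroExt.fst (MonomialAlgebra.lift_pathClass h hZ p)).trans
          (fst_evalPath_dual ZA p.path)
    exact fun x => congr($this x)
  let f : Module.End k (DualExtension k ZB ZA) :=
    (TrivSqZeroExt.sndHom (DualExtension k ZB ZA) (DualExtension k ZB ZA)).restrictScalars k ∘ₗ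
      Φ.toLinearMap
  have hf : ∀ x, f x = (Φ x).snd := fun x => rfl
  have hder : f ∈ derivations k (DualExtension k ZB ZA) := by
    intro x y
    rw [hf, hf, hf, map_mul, TrivSqZeroExt.snd_mul, hfst, hfst, smul_eq_mul,
      MulOpposite.smul_eq_mul_unop, MulOpposite.unop_op, add_comm]
  have hB : ∀ b, f (borelHom k ZB ZA b) = borelHom k ZB ZA (g b) := by
    have : f.comp (borelHom k ZB ZA).toLinearMap = (borelHom k ZB ZA).toLinearMap.comp g := by
      refine MonomialAlgebra.linearMap_ext fun p => ?_
      change f (borelHom k ZB ZA (pathClass k ZB p)) = borelHom k ZB ZA (g (pathClass k ZB p))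
      rw [borelHom_pathClass, hf]
      refine (congrArg TrivSqZeroExt.snd ((MonomialAlgebra.lift_pathClass h hZ _).trans
        (evalPath_dual_map ZA hg p.path))).trans ?_
      simp
    exact fun b => congr($this b)
  have hA : ∀ (i j : V) (a : QA.Hom i j),
      f (arrowClass k (dualRelations ZB ZA) (opArrow QB QA i j a)) = 0 := by
    intro i j a
    refine (congrArg TrivSqZeroExt.snd ((MonomialAlgebra.lift_pathClass h hZ _).trans
      (h.evalPath_toPath _))).trans ?_
    exact TrivSqZeroExt.snd_inl _ _
  refine ⟨⟨f, mem_gradedDer_of hder (fun i => ?_) ?_⟩, hB, hA⟩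
  · rw [← borelHom_vertexClass, hB, gradedDer_apply_vertexClass hg, map_zero]
  · rintro i j (b | a)
    · change f (arrowClass k (dualRelations ZB ZA) (inclArrow QB QA i j b)) ∈ _
      rw [← borelHom_arrowClass, hB]
      have hle : arrowSpan k ZB i j ≤ (lengthGrading k (dualRelations ZB ZA) 1).comap
          (borelHom k ZB ZA).toLinearMap := by
        rw [arrowSpan, Submodule.span_le]
        rintro _ ⟨b, rfl⟩
        change borelHom k ZB ZA (arrowClass k ZB b) ∈ lengthGrading k (dualRelations ZB ZA) 1
        rw [borelHom_arrowClass]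
        exact arrowClass_mem_lengthGrading _
      exact hle (gradedDer_apply_arrowClass hg b)
    · exact (hA j i a).symm ▸ zero_mem _

end Extension

end Borel

theorem two_le_length_of_mem_dualRelations {V : Type w} {QB QA : Quiver.{v} V}
    {ZB : Set (QPath QB)} {ZA : Set (QPath QA)} (hZA : ∀ z ∈ ZA, 2 ≤ z.length)
    (hZB : ∀ z ∈ ZB, 2 ≤ z.length) :
    ∀ z ∈ dualRelations ZB ZA, 2 ≤ z.length := by
  have hop : ∀ {i j : V} (p : @Quiver.Path V QA i j),
      (opPath QB QA ⟨i, j, p⟩).length = (⟨i, j, p⟩ : QPath QA).length := by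
    intro i j p
    induction p with
    | nil => rfl
    | cons p a ih =>
      refine (@Quiver.Path.length_comp V (dualQuiver QB QA) _ _ _ _ _).trans ?_
      refine (Nat.add_comm _ _).trans (congrArg Nat.succ ih)
  rintro z ((⟨p, hp, rfl⟩ | ⟨p, hp, rfl⟩) | ⟨i, j, l, β, α, rfl⟩)
  · refine (hZB p hp).trans_eq ?_
    obtain ⟨i, j, p⟩ := p
    clear hp
    induction p with
    | nil => rfl
    | cons p a ih => exact congrArg Nat.succ ih
  · exact (hZA p hp).trans_eq (hop p.path).symm
  · exact le_rfl

section ExtendBorel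

variable {k : Type u} [Field k] {V : Type w} [DecidableEq V] [Fintype V] {QB QA : Quiver.{v} V}
  {ZB : Set (QPath QB)} {ZA : Set (QPath QA)}

theorem gradedDer_dual_ext {f g : gradedDer k (dualRelations ZB ZA)}
    (hB : ∀ b, f.1 (borelHom k ZB ZA b) = g.1 (borelHom k ZB ZA b))
    (hA : ∀ (i j : V) (a : QA.Hom i j),
      f.1 (arrowClass k (dualRelations ZB ZA) (opArrow QB QA i j a)) =
        g.1 (arrowClass k (dualRelations ZB ZA) (opArrow QB QA i j a))) : f = g := by
  refine Subtype.ext (derivation_ext f.2.1 g.2.1 (fun i => ?_) ?_)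
  · rw [gradedDer_apply_vertexClass f.2, gradedDer_apply_vertexClass g.2]
  · rintro i j (b | a)
    · have := hB (arrowClass k ZB b)
      rwa [borelHom_arrowClass] at this
    · exact hA j i a

variable (ZA) in
/-- The underlying derivation of `extendBorel`. -/
def extendBorelFun (g : gradedDer k ZB) : gradedDer k (dualRelations ZB ZA) :=
  (exists_extension ZA g.2).choose

theorem extendBorelFun_borelHom (g : gradedDer k ZB) (b : MonomialAlgebra k ZB) :
    (extendBorelFun ZA g).1 (borelHom k ZB ZA b) = borelHom k ZB ZA (g.1 b) :=
  (exists_extension ZA g.2).choose_spec.1 b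

theorem extendBorelFun_opArrow (g : gradedDer k ZB) {i j : V} (a : QA.Hom i j) :
    (extendBorelFun ZA g).1 (arrowClass k (dualRelations ZB ZA) (opArrow QB QA i j a)) = 0 :=
  (exists_extension ZA g.2).choose_spec.2 i j a

variable (k ZB ZA) in
/-- The extension of derivations of `B` that preserve the length to the dual extension, by zero
on the arrows of `A`. -/
def extendBorel : gradedDer k ZB →ₗ⁅k⁆ gradedDer k (dualRelations ZB ZA) where
  toFun := extendBorelFun ZA
  map_add' f g := by
    refine gradedDer_dual_ext (fun b => ?_) fun i j a => ?_
    · change _ = (extendBorelFun ZA f).1 _ + (extendBorelFun ZA g).1 _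
      rw [extendBorelFun_borelHom, extendBorelFun_borelHom, extendBorelFun_borelHom, ← map_add]
      rfl
    · change _ = (extendBorelFun ZA f).1 _ + (extendBorelFun ZA g).1 _
      rw [extendBorelFun_opArrow, extendBorelFun_opArrow, extendBorelFun_opArrow, add_zero]
  map_smul' r f := by
    refine gradedDer_dual_ext (fun b => ?_) fun i j a => ?_
    · change _ = r • (extendBorelFun ZA f).1 _
      rw [extendBorelFun_borelHom, extendBorelFun_borelHom, ← map_smul]
      rfl
    · change _ = r • (extendBorelFun ZA f).1 _
      rw [extendBorelFun_opArrow, extendBorelFun_opArrow, smul_zero]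
  map_lie' := by
    intro f g
    refine gradedDer_dual_ext (fun b => ?_) fun i j a => ?_
    · change _ = (extendBorelFun ZA f).1 ((extendBorelFun ZA g).1 _) -
        (extendBorelFun ZA g).1 ((extendBorelFun ZA f).1 _)
      simp only [extendBorelFun_borelHom]
      rw [← map_sub]
      rfl
    · change _ = (extendBorelFun ZA f).1 ((extendBorelFun ZA g).1 _) -
        (extendBorelFun ZA g).1 ((extendBorelFun ZA f).1 _)
      simp only [extendBorelFun_opArrow, map_zero, sub_zero]

theorem extendBorel_borelHom (g : gradedDer k ZB) (b : MonomialAlgebra k ZB) :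
    (extendBorel k ZB ZA g).1 (borelHom k ZB ZA b) = borelHom k ZB ZA (g.1 b) :=
  extendBorelFun_borelHom g b

theorem extendBorel_opArrow (g : gradedDer k ZB) {i j : V} (a : QA.Hom i j) :
    (extendBorel k ZB ZA g).1 (arrowClass k (dualRelations ZB ZA) (opArrow QB QA i j a)) = 0 :=
  extendBorelFun_opArrow g a

variable (hZA : ∀ z ∈ ZA, 2 ≤ z.length) (hdir : ∀ i j, QB.Hom i j → QA.Hom j i → False)

include hZA in
theorem borelHom_injective : Function.Injective (borelHom k ZB ZA) :=
  Function.LeftInverse.injective (borelProj_borelHom hZA)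

theorem restrictBorel_extendBorel (g : gradedDer k ZB) :
    restrictBorel hZA hdir (extendBorel k ZB ZA g) = g := by
  refine Subtype.ext (LinearMap.ext fun b => borelHom_injective hZA ?_)
  rw [borelHom_restrictBorel, extendBorel_borelHom]

theorem borelHom_diag (c : V → k) :
    borelHom k ZB ZA (diag k ZB c) = diag k (dualRelations ZB ZA) c := by
  simp only [diag_apply, map_sum, map_smul, borelHom_vertexClass]

theorem restrictBorel_adDiag (c : V → k) :
    restrictBorel hZA hdir (adDiag k (dualRelations ZB ZA) c) = adDiag k ZB c := by
  refine Subtype.ext (LinearMap.ext fun b => borelHom_injective (ZA := ZA) hZA ?_)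
  rw [borelHom_restrictBorel]
  change ad k (diag k (dualRelations ZB ZA) c) _ = borelHom k ZB ZA (ad k (diag k ZB c) b)
  simp only [ad_apply, map_sub, map_mul, borelHom_diag]

theorem apply_borelHom_of_restrictBorel_eq_zero {f : gradedDer k (dualRelations ZB ZA)}
    (hf : restrictBorel hZA hdir f = 0) (b : MonomialAlgebra k ZB) :
    f.1 (borelHom k ZB ZA b) = 0 := by
  rw [← borelHom_restrictBorel hZA hdir, hf]
  exact map_zero _

/-- Extensions of derivations of `B` commute with the derivations that vanish on `B`. -/
theorem extendBorel_lie_of_restrictBorel_eq_zero (g : gradedDer k ZB)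
    {f : gradedDer k (dualRelations ZB ZA)} (hf : restrictBorel hZA hdir f = 0) :
    ⁅extendBorel k ZB ZA g, f⁆ = 0 := by
  have hf' := apply_borelHom_of_restrictBorel_eq_zero hZA hdir hf
  refine gradedDer_dual_ext (fun b => ?_) fun i j a => ?_
  · change (extendBorel k ZB ZA g).1 (f.1 _) - f.1 ((extendBorel k ZB ZA g).1 _) = 0
    rw [extendBorel_borelHom, hf', hf', map_zero, sub_zero]
  · change (extendBorel k ZB ZA g).1 (f.1 _) - f.1 ((extendBorel k ZB ZA g).1 _) = 0
    rw [extendBorel_opArrow, map_zero, sub_zero]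
    have hle : arrowSpan k (dualRelations ZB ZA) j i ≤
        LinearMap.ker (extendBorel k ZB ZA g).1 := by
      rw [arrowSpan, Submodule.span_le]
      rintro _ ⟨b | a', rfl⟩
      · exact (hdir j i b a).elim
      · exact extendBorel_opArrow g a'
    exact hle (gradedDer_apply_arrowClass f.2 (opArrow QB QA i j a))

/-- The derivations that are bimodule maps over `B` are the derivations that vanish on `B`. -/
theorem mem_relDerivations_iff (f : gradedDer k (dualRelations ZB ZA)) :
    f.1 ∈ relDerivations k (borel k ZB ZA) ↔ restrictBorel hZA hdir f = 0 := by
  have hf' : ∀ x y, f.1 (x * y) = f.1 x * y + x * f.1 y := f.2.1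
  constructor
  · intro h
    refine Subtype.ext (LinearMap.ext fun b => borelHom_injective (ZA := ZA) hZA ?_)
    rw [borelHom_restrictBorel]
    have h₁ : f.1 1 = 0 := by simpa using hf' 1 1
    have h₂ := h.2 (borelHom k ZB ZA b) ⟨b, rfl⟩ 1 (one_mem _) 1
    rw [mul_one, mul_one, h₁, mul_zero, zero_mul] at h₂
    exact h₂.trans (map_zero (borelHom k ZB ZA)).symm
  · intro h
    refine ⟨f.2.1, ?_⟩
    rintro _ ⟨b, rfl⟩ _ ⟨b', rfl⟩ x
    have hb := apply_borelHom_of_restrictBorel_eq_zero hZA hdir h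
    change f.1 (borelHom k ZB ZA b * x * borelHom k ZB ZA b') =
      borelHom k ZB ZA b * f.1 x * borelHom k ZB ZA b'
    rw [hf', hf', hb, hb, zero_mul, zero_add, mul_zero, add_zero]

end ExtendBorel

/-! ### Lie algebras of classes -/

section LieClasses

variable {k : Type u} [Field k]

/-- Two surjective homomorphisms of Lie algebras with the same kernel have isomorphic targets. -/
theorem nonempty_lieEquiv_of_ker_eq {L M N : Type*} [LieRing L] [LieAlgebra k L] [LieRing M]
    [LieAlgebra k M] [LieRing N] [LieAlgebra k N] (f : L →ₗ⁅k⁆ M) (g : L →ₗ⁅k⁆ N)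
    (hf : Function.Surjective f) (hg : Function.Surjective g) (h : ∀ x, f x = 0 ↔ g x = 0) :
    Nonempty (M ≃ₗ⁅k⁆ N) := by
  have hk : LinearMap.ker (f : L →ₗ[k] M) = LinearMap.ker (g : L →ₗ[k] N) := by
    ext x
    exact h x
  let e : M ≃ₗ[k] N := ((f : L →ₗ[k] M).quotKerEquivOfSurjective hf).symm ≪≫ₗ
    Submodule.quotEquivOfEq _ _ hk ≪≫ₗ (g : L →ₗ[k] N).quotKerEquivOfSurjective hg
  have he : ∀ x, e (f x) = g x := by
    intro x
    have : ((f : L →ₗ[k] M).quotKerEquivOfSurjective hf).symm (f x) = Submodule.Quotient.mk x := by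
      rw [LinearEquiv.symm_apply_eq]
      rfl
    simp only [e, LinearEquiv.trans_apply, this]
    rfl
  refine ⟨{ e with map_lie' := ?_ }⟩
  intro x y
  obtain ⟨x, rfl⟩ := hf x
  obtain ⟨y, rfl⟩ := hf y
  change e ⁅f x, f y⁆ = ⁅e (f x), e (f y)⁆
  rw [← LieHom.map_lie, he, he, he, LieHom.map_lie]

/-- For a homomorphism `r` of Lie algebras that is split by `s`, with the image of `s` commuting
with the kernel of `r`, the projection to the kernel of `r` along `s`, shifted by central
elements. -/
def splitComplement {L M E : Type*} [LieRing L] [LieAlgebra k L] [LieRing M] [LieAlgebra k M]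
    [AddCommGroup E] [Module k E] (r : L →ₗ⁅k⁆ M) (s : M →ₗ⁅k⁆ L)
    (hs : ∀ (g : M) (f : L), ⁅s g, f⁆ = s ⁅g, r f⁆) (hrs : ∀ g, r (s g) = g)
    (c : E →ₗ[k] L) (hc : ∀ (f : L) (x : E), ⁅f, c x⁆ = 0) (φ : M →ₗ[k] E)
    (hφ : ∀ f g : M, φ ⁅f, g⁆ = 0) : L →ₗ⁅k⁆ L where
  toFun f := f - (s (r f) + c (φ (r f)))
  map_add' f g := by
    simp only [map_add]
    abel
  map_smul' a f := by
    simp only [map_smul, RingHom.id_apply, smul_sub, smul_add]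
  map_lie' {f g} := by
    have hc' : ∀ (f : L) (x : E), ⁅c x, f⁆ = 0 := fun f x => by rw [← lie_skew, hc, neg_zero]
    have hs' : ∀ (f : L) (g : M), ⁅f, s g⁆ = s ⁅r f, g⁆ := fun f g => by
      rw [← lie_skew, hs, ← map_neg, lie_skew]
    simp only [lie_sub, sub_lie, add_lie, lie_add]
    simp only [LieHom.map_lie r, hφ, map_zero, hc, hc', hs', hs, hrs]
    abel

variable {A : Type v} [Ring A] [Algebra k A] (D P : LieSubalgebra k (Module.End k A))
  (hD : D ≤ derivations k A)

/-- The class of an element of `D` lying in `P`. -/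
def toClassesIn : ↥(D ⊓ P) →ₗ⁅k⁆ classesIn k D P (innerIdeal k D hD) where
  toFun f := ⟨LieSubmodule.Quotient.mk ⟨f.1, f.2.1⟩, ⟨f.1, f.2.1⟩, f.2.2, rfl⟩
  map_add' _ _ := rfl
  map_smul' _ _ := rfl
  map_lie' := rfl

theorem toClassesIn_surjective : Function.Surjective (toClassesIn D P hD) := by
  rintro ⟨_, f, hf, rfl⟩
  exact ⟨⟨f.1, f.2, hf⟩, rfl⟩

theorem toClassesIn_eq_zero_iff (f : ↥(D ⊓ P)) :
    toClassesIn D P hD f = 0 ↔ ∃ x, (f : Module.End k A) = ad k x := by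
  rw [← Subtype.coe_inj]
  exact LieSubmodule.Quotient.mk_eq_zero' (N := innerIdeal k D hD) (m := ⟨f.1, f.2.1⟩)

end LieClasses

/-! ### The decomposition -/

section Decomposition

variable {k : Type u} [Field k] {V : Type w} [DecidableEq V] [Fintype V] {QB QA : Quiver.{v} V}
  {ZB : Set (QPath QB)} {ZA : Set (QPath QA)}
  (hZA : ∀ z ∈ ZA, 2 ≤ z.length) (hdir : ∀ i j, QB.Hom i j → QA.Hom j i → False)

variable (k ZB ZA) in
/-- The part on `A` of the inner derivation by a combination of vertices. -/
def adDiagOp : (V → k) →ₗ[k] gradedDer k (dualRelations ZB ZA) :=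
  adDiag k (dualRelations ZB ZA) - (extendBorel k ZB ZA : _ →ₗ[k] _).comp (adDiag k ZB)

theorem adDiagOp_apply (c : V → k) : adDiagOp k ZB ZA c =
    adDiag k (dualRelations ZB ZA) c - extendBorel k ZB ZA (adDiag k ZB c) := rfl

theorem restrictBorel_adDiagOp (c : V → k) : restrictBorel hZA hdir (adDiagOp k ZB ZA c) = 0 := by
  rw [adDiagOp_apply, map_sub, restrictBorel_adDiag, restrictBorel_extendBorel, sub_self]

theorem restrictBorel_sub_extendBorel (f : gradedDer k (dualRelations ZB ZA)) :
    restrictBorel hZA hdir (f - extendBorel k ZB ZA (restrictBorel hZA hdir f)) = 0 := by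
  rw [map_sub, restrictBorel_extendBorel, sub_self]

theorem extendBorel_lie (g : gradedDer k ZB) (f : gradedDer k (dualRelations ZB ZA)) :
    ⁅extendBorel k ZB ZA g, f⁆ = extendBorel k ZB ZA ⁅g, restrictBorel hZA hdir f⁆ := by
  have h := extendBorel_lie_of_restrictBorel_eq_zero hZA hdir g
    (restrictBorel_sub_extendBorel hZA hdir f)
  rwa [lie_sub, sub_eq_zero, ← LieHom.map_lie] at h

include hZA hdir in
theorem lie_adDiagOp (f : gradedDer k (dualRelations ZB ZA)) (c : V → k) :
    ⁅f, adDiagOp k ZB ZA c⁆ = 0 := by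
  rw [adDiagOp_apply, lie_sub, lie_adDiag, zero_sub, neg_eq_zero, ← lie_skew,
    extendBorel_lie hZA hdir, ← lie_skew, lie_adDiag, neg_zero, map_zero, neg_zero]

variable (φ : gradedDer k ZB →ₗ[k] (V → k))

/-- The component relative to `B` of a derivation of the dual extension, after the correction
by the inner derivation prescribed by `φ`. -/
def relPart (hφ : ∀ f g : gradedDer k ZB, φ ⁅f, g⁆ = 0) :
    gradedDer k (dualRelations ZB ZA) →ₗ⁅k⁆ gradedDer k (dualRelations ZB ZA) :=
  splitComplement (restrictBorel hZA hdir) (extendBorel k ZB ZA) (extendBorel_lie hZA hdir)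
    (restrictBorel_extendBorel hZA hdir) (adDiagOp k ZB ZA) (lie_adDiagOp hZA hdir) φ hφ

theorem relPart_apply (hφ : ∀ f g : gradedDer k ZB, φ ⁅f, g⁆ = 0)
    (f : gradedDer k (dualRelations ZB ZA)) : relPart hZA hdir φ hφ f =
      f - (extendBorel k ZB ZA (restrictBorel hZA hdir f) +
        adDiagOp k ZB ZA (φ (restrictBorel hZA hdir f))) := rfl

theorem restrictBorel_relPart (hφ : ∀ f g : gradedDer k ZB, φ ⁅f, g⁆ = 0)
    (f : gradedDer k (dualRelations ZB ZA)) :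
    restrictBorel hZA hdir (relPart hZA hdir φ hφ f) = 0 := by
  rw [relPart_apply, map_sub, map_add, restrictBorel_extendBorel, restrictBorel_adDiagOp,
    add_zero, sub_self]

/-- `relPart` with values in the derivations that are bimodule maps over `B`. -/
def toRelDerivations (hφ : ∀ f g : gradedDer k ZB, φ ⁅f, g⁆ = 0) :
    gradedDer k (dualRelations ZB ZA) →ₗ⁅k⁆
      ↥(relDerivations k (borel k ZB ZA) ⊓
        degreePreserving k (lengthGrading k (dualRelations ZB ZA))) where
  toFun f := ⟨(relPart hZA hdir φ hφ f).1,
    (mem_relDerivations_iff hZA hdir _).2 (restrictBorel_relPart hZA hdir φ hφ f),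
    (relPart hZA hdir φ hφ f).2.2⟩
  map_add' f g := Subtype.ext (Subtype.ext_iff.1 (map_add (relPart hZA hdir φ hφ) f g) :)
  map_smul' r f := Subtype.ext (Subtype.ext_iff.1 (map_smul (relPart hZA hdir φ hφ) r f) :)
  map_lie' {f g} :=
    Subtype.ext (Subtype.ext_iff.1 (LieHom.map_lie (relPart hZA hdir φ hφ) f g) :)

theorem adDiag_eq_add (c : V → k) : adDiag k (dualRelations ZB ZA) c =
    extendBorel k ZB ZA (adDiag k ZB c) + adDiagOp k ZB ZA c := by
  rw [adDiagOp_apply, add_sub_cancel]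

/-- The kernel of the decomposition consists of the inner derivations. -/
theorem exists_adDiag_iff (hφ : ∀ f g : gradedDer k ZB, φ ⁅f, g⁆ = 0)
    (hφ' : ∀ c, adDiag k ZB (φ (adDiag k ZB c)) = adDiag k ZB c)
    (f : gradedDer k (dualRelations ZB ZA)) :
    (∃ c, f = adDiag k (dualRelations ZB ZA) c) ↔
      (∃ c, restrictBorel hZA hdir f = adDiag k ZB c) ∧
        ∃ c, relPart hZA hdir φ hφ f = adDiag k (dualRelations ZB ZA) c := by
  constructor
  · rintro ⟨c, rfl⟩
    refine ⟨⟨c, restrictBorel_adDiag hZA hdir c⟩, c - φ (adDiag k ZB c), ?_⟩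
    rw [relPart_apply, restrictBorel_adDiag, adDiag_eq_add c, adDiag_eq_add (c - _), map_sub,
      map_sub, map_sub, hφ', sub_self, zero_add]
    abel
  · rintro ⟨⟨c, hc⟩, d, hd⟩
    refine ⟨φ (adDiag k ZB c) + d, ?_⟩
    rw [map_add, ← hd, relPart_apply, hc, adDiag_eq_add, hφ']
    abel

variable (k) in
/-- The class in `HH¹` of a derivation of a monomial algebra that preserves the length. -/
def gradedDerClass {Q : Quiver.{v} V} (Z : Set (QPath Q)) :
    gradedDer k Z →ₗ⁅k⁆ HH1DegOne k (lengthGrading k Z) :=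
  toClassesIn (derivations k (MonomialAlgebra k Z)) (degreePreserving k (lengthGrading k Z)) le_rfl

theorem gradedDerClass_surjective {Q : Quiver.{v} V} (Z : Set (QPath Q)) :
    Function.Surjective (gradedDerClass k Z) :=
  toClassesIn_surjective _ _ _

theorem isInner_iff {Q : Quiver.{v} V} [∀ i j, Fintype (Q.Hom i j)] {Z : Set (QPath Q)}
    (hZ : ∀ z ∈ Z, 2 ≤ z.length) (f : gradedDer k Z) :
    (∃ x, f.1 = ad k x) ↔ ∃ c, f = adDiag k Z c :=
  ⟨exists_adDiag_eq hZ f, fun ⟨_, hc⟩ => ⟨_, congrArg Subtype.val hc⟩⟩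

theorem gradedDerClass_eq_zero_iff {Q : Quiver.{v} V} [∀ i j, Fintype (Q.Hom i j)]
    {Z : Set (QPath Q)} (hZ : ∀ z ∈ Z, 2 ≤ z.length) (f : gradedDer k Z) :
    gradedDerClass k Z f = 0 ↔ ∃ c, f = adDiag k Z c :=
  (toClassesIn_eq_zero_iff _ _ _ f).trans (isInner_iff hZ f)

/-- The class in relative `HH¹` of the component relative to `B` of a derivation. -/
def relClass (hφ : ∀ f g : gradedDer k ZB, φ ⁅f, g⁆ = 0) :
    gradedDer k (dualRelations ZB ZA) →ₗ⁅k⁆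
      RelHH1DegOne k (lengthGrading k (dualRelations ZB ZA)) (borel k ZB ZA) :=
  (toClassesIn (relDerivations k (borel k ZB ZA))
    (degreePreserving k (lengthGrading k (dualRelations ZB ZA))) inf_le_left).comp
      (toRelDerivations hZA hdir φ hφ)

theorem relClass_eq_zero_iff [∀ i j, Fintype ((dualQuiver QB QA).Hom i j)]
    (hZ : ∀ z ∈ dualRelations ZB ZA, 2 ≤ z.length)
    (hφ : ∀ f g : gradedDer k ZB, φ ⁅f, g⁆ = 0) (f : gradedDer k (dualRelations ZB ZA)) :
    relClass hZA hdir φ hφ f = 0 ↔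
      ∃ c, relPart hZA hdir φ hφ f = adDiag k (dualRelations ZB ZA) c :=
  (toClassesIn_eq_zero_iff _ _ _ (toRelDerivations hZA hdir φ hφ f)).trans
    (isInner_iff hZ (relPart hZA hdir φ hφ f))

theorem prod_class_surjective (hφ : ∀ f g : gradedDer k ZB, φ ⁅f, g⁆ = 0) :
    Function.Surjective (LieHom.prod
      ((gradedDerClass k ZB).comp (restrictBorel hZA hdir)) (relClass hZA hdir φ hφ)) := by
  rintro ⟨x, y⟩
  obtain ⟨g, rfl⟩ := gradedDerClass_surjective ZB x
  obtain ⟨h, rfl⟩ := toClassesIn_surjective _ _ _ y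
  let h' : gradedDer k (dualRelations ZB ZA) := ⟨h.1, h.2.1.1, h.2.2⟩
  have hh : restrictBorel hZA hdir h' = 0 := (mem_relDerivations_iff hZA hdir h').1 h.2.1
  let f : gradedDer k (dualRelations ZB ZA) :=
    extendBorel k ZB ZA g + h' + adDiagOp k ZB ZA (φ g)
  have h₁ : restrictBorel hZA hdir f = g := by
    rw [map_add, map_add, restrictBorel_extendBorel, hh, restrictBorel_adDiagOp, add_zero,
      add_zero]
  have h₂ : relPart hZA hdir φ hφ f = h' := by
    rw [relPart_apply, h₁]
    simp only [f]
    abel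
  have h₃ : toRelDerivations hZA hdir φ hφ f = h := Subtype.ext (Subtype.ext_iff.1 h₂ :)
  exact ⟨f, Prod.ext (congrArg (gradedDerClass k ZB) h₁) (congrArg (toClassesIn _ _ _) h₃)⟩

end Decomposition

end DualExt

end

open DualExt in
theorem theoremB {k : Type u} [Field k] [IsAlgClosed k] [CharZero k] {n : ℕ}
    (QB QA : Quiver.{v} (Fin n))
    (hfB : ∀ i j : Fin n, Finite (QB.Hom i j)) (hfA : ∀ i j : Fin n, Finite (QA.Hom i j))
    (hQB : ∀ i j : Fin n, QB.Hom i j → i < j) (hQA : ∀ i j : Fin n, QA.Hom i j → i < j)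
    (ZB : Set (DualExt.QPath QB)) (ZA : Set (DualExt.QPath QA))
    (hZB : ∀ r ∈ ZB, 2 ≤ r.length) (hZA : ∀ r ∈ ZA, 2 ≤ r.length) :
    Nonempty
      (DualExt.HH1DegOne k (DualExt.lengthGrading k (DualExt.dualRelations ZB ZA)) ≃ₗ⁅k⁆
        (DualExt.HH1DegOne k (DualExt.lengthGrading k ZB) ×
          DualExt.RelHH1DegOne k (DualExt.lengthGrading k (DualExt.dualRelations ZB ZA))
            (DualExt.borel k ZB ZA))) := by
  have hdir : ∀ i j, QB.Hom i j → QA.Hom j i → False := fun i j b a =>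
    lt_asymm (hQB i j b) (hQA j i a)
  let _ : ∀ i j, Fintype (QB.Hom i j) := fun i j => Fintype.ofFinite _
  let _ : ∀ i j, Fintype (QA.Hom i j) := fun i j => Fintype.ofFinite _
  let _ : ∀ i j, Fintype ((dualQuiver QB QA).Hom i j) := fun i j =>
    inferInstanceAs (Fintype (QB.Hom i j ⊕ QA.Hom j i))
  have hZ := two_le_length_of_mem_dualRelations hZA hZB
  obtain ⟨φ, hφ, hφ'⟩ := exists_retraction_adDiag (k := k) hZB
  refine nonempty_lieEquiv_of_ker_eq (gradedDerClass k (dualRelations ZB ZA))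
    (LieHom.prod ((gradedDerClass k ZB).comp (restrictBorel hZA hdir)) (relClass hZA hdir φ hφ))
    (gradedDerClass_surjective _) (prod_class_surjective hZA hdir φ hφ) fun f => ?_
  rw [gradedDerClass_eq_zero_iff hZ, exists_adDiag_iff hZA hdir φ hφ hφ',
    ← gradedDerClass_eq_zero_iff hZB, ← relClass_eq_zero_iff hZA hdir φ hZ hφ]
  exact Prod.mk_eq_zero.symm
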